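/- **Pizzetti's formula for Dunkl operators.** Let $d\ge 1$, let $\langle\cdot,\cdot\rangle$ be the standard inner product on $\mathbb{R}^d$, and let $R\subset\mathbb{R}^d\setminus\{0\}$ be a finite reduced root system, not necessarily crystallographic or spanning: $r_\alpha R=R$ and $R\cap\mathbb{R}\alpha=\{\pm\alpha\}$ for all $\alpha\in R$, where $r_\alpha$ is the reflection in the hyperplane $\alpha^\perp$. Let $R_+\subset R$ be a positive system, that is, $R_+=\{\alpha\in R:\langle\alpha,\beta\rangle>0\}$ for some $\beta$ orthogonal to no root, let $G$ be the group generated by the $r_\alpha$ ($\alpha\in R$), and let $\kappa:R\to\mathbb{R}_{\ge 0}$, $\alpha\mapsto\kappa_\alpha$, be $G$-invariant. Put $$\lambda_\kappa=\frac d2-1+\sum_{\alpha\in R_+}\kappa_\alpha,\qquad h_\kappa(x)=\prod_{\alpha\in R_+}|\langle\alpha,x\rangle|^{\kappa_\alpha},\qquad \omega_{\kappa,d}=\int_{S^{d-1}}h_\kappa^2(y)\,d\sigma(y),$$ where $\sigma$ is the surface measure on the unit sphere $S^{d-1}$ (the counting measure if $d=1$). For $\xi\in\mathbb{R}^d$ let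 $$\mathscr{D}_\xi f(x)=\partial_\xi f(x)+\sum_{\alpha\in R_+}\kappa_\alpha\langle\alpha,\xi\rangle\frac{f(x)-f(r_\alpha x)}{\langle\alpha,x\rangle},$$ where for $\langle\alpha,x\rangle=0$ the quotient stands for its continuous extension $2\,\partial_\alpha f(x)/\langle\alpha,\alpha\rangle$, and let $\Delta_\kappa=\sum_{j=1}^d\mathscr{D}_{e_j}^2$ be the Dunkl Laplacian, where $e_1,\dots,e_d$ is the standard basis. Let $(a)_0=1$ and $(a)_n=a(a+1)\cdots(a+n-1)$. Let $f$ be a real- or complex-valued function. Then $\omega_{\kappa,d}>0$, and the following hold. 1. If $f$ is $C^\infty$ on a neighbourhood of $0\in\mathbb{R}^d$, then $y\mapsto f(ry)h_\kappa^2(y)$ is integrable on $S^{d-1}$ for all sufficiently small $r>0$ and, for every integer $N\ge 0$, $$\frac1{\omega_{\kappa,d}}\int_{S^{d-1}}f(ry)\,h_\kappa^2(y)\,d\sigma(y)=\sum_{n=0}^N\frac{(\Delta_\kappa^n f)(0)}{n!\,(\lambda_\kappa+1)_n}\Bigl(\frac r2\Bigr)^{2n}+o(r^{2N})\qquad(r\to+0).$$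 2. If $f$ is real analytic in the open ball of radius $1$ around $0\in\mathbb{R}^d$, then there is a constant $\rho\in(0,1)$ such that, for every $r$ with $0<r<\rho$, the function $y\mapsto f(ry)h_\kappa^2(y)$ is integrable on $S^{d-1}$, the series below converges, and $$\frac1{\omega_{\kappa,d}}\int_{S^{d-1}}f(ry)\,h_\kappa^2(y)\,d\sigma(y)=\sum_{n=0}^\infty\frac{(\Delta_\kappa^n f)(0)}{n!\,(\lambda_\kappa+1)_n}\Bigl(\frac r2\Bigr)^{2n}.$$ -/

import Mathlib

open MeasureTheory Filter Topology Asymptotics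
open scoped RealInnerProductSpace ContDiff

noncomputable section

namespace Dunkl

/-- The reflection `r_α` in the hyperplane `α^⊥`. -/
def refl {d : ℕ} (α : EuclideanSpace ℝ (Fin d)) :
    EuclideanSpace ℝ (Fin d) ≃ₗᵢ[ℝ] EuclideanSpace ℝ (Fin d) :=
  (ℝ ∙ α)ᗮ.reflection

/-- A (finite) reduced root system in `ℝ^d`, not necessarily crystallographic, and not
necessarily spanning `ℝ^d`. -/
structure IsReducedRootSystem {d : ℕ} (R : Finset (EuclideanSpace ℝ (Fin d))) : Prop where
  zero_notMem : (0 : EuclideanSpace ℝ (Fin d)) ∉ R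
  refl_mem : ∀ α ∈ R, ∀ β ∈ R, refl α β ∈ R
  reduced : ∀ α ∈ R, ∀ c : ℝ, c • α ∈ R → c = 1 ∨ c = -1

/-- The finite reflection group `G` generated by the `r_α`, `α ∈ R`. -/
def reflectionGroup {d : ℕ} (R : Finset (EuclideanSpace ℝ (Fin d))) :
    Subgroup (EuclideanSpace ℝ (Fin d) ≃ₗᵢ[ℝ] EuclideanSpace ℝ (Fin d)) :=
  Subgroup.closure (refl '' (R : Set (EuclideanSpace ℝ (Fin d))))

/-- `P` is a positive system of `R`: the roots on the positive side of a hyperplane through the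
origin that contains no root. -/
def IsPositiveSystem {d : ℕ} (R P : Finset (EuclideanSpace ℝ (Fin d))) : Prop :=
  ∃ β : EuclideanSpace ℝ (Fin d), (∀ α ∈ R, ⟪α, β⟫ ≠ 0) ∧ ∀ α, α ∈ P ↔ α ∈ R ∧ 0 < ⟪α, β⟫

/-- `κ` is a non-negative `G`-invariant function on `R` (its values off `R` are irrelevant). -/
structure IsMultiplicity {d : ℕ} (R : Finset (EuclideanSpace ℝ (Fin d)))
    (κ : EuclideanSpace ℝ (Fin d) → ℝ) : Prop where
  nonneg : ∀ α ∈ R, 0 ≤ κ α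
  invariant : ∀ g ∈ reflectionGroup R, ∀ α ∈ R, κ (g α) = κ α

/-- `λ_κ = d/2 - 1 + ∑_{α ∈ R_+} κ_α`. -/
def lam {d : ℕ} (P : Finset (EuclideanSpace ℝ (Fin d))) (κ : EuclideanSpace ℝ (Fin d) → ℝ) : ℝ :=
  (d : ℝ) / 2 - 1 + ∑ α ∈ P, κ α

open Classical in
/-- The quotient `(f(x) - f(r_α x)) / ⟨α, x⟩`. On the hyperplane `⟨α, x⟩ = 0` it is given, as usual
for Dunkl operators, by its continuous extension `2 ∂_α f(x) / ⟨α, α⟩`, see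
`tendsto_diffQuot`. -/
def diffQuot {d : ℕ} {F : Type*} [NormedAddCommGroup F] [NormedSpace ℝ F]
    (α : EuclideanSpace ℝ (Fin d)) (f : EuclideanSpace ℝ (Fin d) → F)
    (x : EuclideanSpace ℝ (Fin d)) : F :=
  if ⟪α, x⟫ = 0 then (2 / ⟪α, α⟫) • fderiv ℝ f x α
  else ⟪α, x⟫⁻¹ • (f x - f (refl α x))

/-- The Dunkl operator `D_ξ`. -/
def dunklOp {d : ℕ} {F : Type*} [NormedAddCommGroup F] [NormedSpace ℝ F]
    (P : Finset (EuclideanSpace ℝ (Fin d))) (κ : EuclideanSpace ℝ (Fin d) → ℝ)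
    (ξ : EuclideanSpace ℝ (Fin d)) (f : EuclideanSpace ℝ (Fin d) → F)
    (x : EuclideanSpace ℝ (Fin d)) : F :=
  fderiv ℝ f x ξ + ∑ α ∈ P, (κ α * ⟪α, ξ⟫) • diffQuot α f x

/-- The Dunkl Laplacian `Δ_κ = ∑_j D_j²`, where `D_j` is the Dunkl operator in the direction of the
standard basis vector `e_j`. -/
def laplacian {d : ℕ} {F : Type*} [NormedAddCommGroup F] [NormedSpace ℝ F]
    (P : Finset (EuclideanSpace ℝ (Fin d))) (κ : EuclideanSpace ℝ (Fin d) → ℝ)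
    (f : EuclideanSpace ℝ (Fin d) → F) (x : EuclideanSpace ℝ (Fin d)) : F :=
  ∑ j : Fin d, dunklOp P κ (EuclideanSpace.single j 1)
    (dunklOp P κ (EuclideanSpace.single j 1) f) x

/-- The weight `h_κ(x) = ∏_{α ∈ R_+} |⟨α, x⟩|^{κ_α}`. -/
def weight {d : ℕ} (P : Finset (EuclideanSpace ℝ (Fin d))) (κ : EuclideanSpace ℝ (Fin d) → ℝ)
    (x : EuclideanSpace ℝ (Fin d)) : ℝ :=
  ∏ α ∈ P, |⟪α, x⟫| ^ κ α

/-- The surface measure on the unit sphere (for `d = 1`, the counting measure on two points). -/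
def surface (d : ℕ) : Measure (Metric.sphere (0 : EuclideanSpace ℝ (Fin d)) 1) :=
  (volume : Measure (EuclideanSpace ℝ (Fin d))).toSphere

/-- `ω_{κ,d} = ∫_{S^{d-1}} h_κ² dσ`. -/
def omega {d : ℕ} (P : Finset (EuclideanSpace ℝ (Fin d))) (κ : EuclideanSpace ℝ (Fin d) → ℝ) : ℝ :=
  ∫ y, weight P κ (y : EuclideanSpace ℝ (Fin d)) ^ 2 ∂(surface d)

/-- The integrand `y ↦ f(ry) h_κ(y)²` on the unit sphere. -/
def integrand {d : ℕ} {F : Type*} [NormedAddCommGroup F] [NormedSpace ℝ F]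
    (P : Finset (EuclideanSpace ℝ (Fin d))) (κ : EuclideanSpace ℝ (Fin d) → ℝ)
    (f : EuclideanSpace ℝ (Fin d) → F) (r : ℝ)
    (y : Metric.sphere (0 : EuclideanSpace ℝ (Fin d)) 1) : F :=
  weight P κ (y : EuclideanSpace ℝ (Fin d)) ^ 2 • f (r • (y : EuclideanSpace ℝ (Fin d)))

/-- The weighted spherical mean `ω_{κ,d}⁻¹ ∫_{S^{d-1}} f(ry) h_κ(y)² dσ(y)`. -/
def sphericalMean {d : ℕ} {F : Type*} [NormedAddCommGroup F] [NormedSpace ℝ F]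
    (P : Finset (EuclideanSpace ℝ (Fin d))) (κ : EuclideanSpace ℝ (Fin d) → ℝ)
    (f : EuclideanSpace ℝ (Fin d) → F) (r : ℝ) : F :=
  (omega P κ)⁻¹ • ∫ y, integrand P κ f r y ∂(surface d)

/-- The `n`-th term `(Δ_κ^n f)(0) / (n! (λ_κ + 1)_n) * (r/2)^{2n}` of the Pizzetti series. -/
def pizzettiTerm {d : ℕ} {F : Type*} [NormedAddCommGroup F] [NormedSpace ℝ F]
    (P : Finset (EuclideanSpace ℝ (Fin d))) (κ : EuclideanSpace ℝ (Fin d) → ℝ)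
    (f : EuclideanSpace ℝ (Fin d) → F) (r : ℝ) (n : ℕ) : F :=
  ((r / 2) ^ (2 * n) / ((n.factorial : ℝ) * (ascPochhammer ℝ n).eval (lam P κ + 1))) •
    ((laplacian P κ)^[n] f) 0

theorem refl_apply {d : ℕ} (α x : EuclideanSpace ℝ (Fin d)) :
    refl α x = x - (2 * ⟪α, x⟫ / ⟪α, α⟫) • α := by
  rw [refl, Submodule.reflection_orthogonal_apply, Submodule.reflection_singleton_apply,
    real_inner_self_eq_norm_sq]
  simp only [RCLike.ofReal_real_eq_id, id_eq, neg_sub, ← smul_assoc, nsmul_eq_mul]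
  congr 2
  push_cast
  ring

/-- The value of `diffQuot` on the hyperplane is the limit of the difference quotients. -/
theorem tendsto_diffQuot {d : ℕ} {F : Type*} [NormedAddCommGroup F] [NormedSpace ℝ F]
    {α : EuclideanSpace ℝ (Fin d)} {f : EuclideanSpace ℝ (Fin d) → F}
    {x : EuclideanSpace ℝ (Fin d)} (hx : ⟪α, x⟫ = 0) (hf : ContDiffAt ℝ 1 f x) :
    Tendsto (fun z => ⟪α, z⟫⁻¹ • (f z - f (refl α z))) (𝓝[{z | ⟪α, z⟫ ≠ 0}] x)
      (𝓝 (diffQuot α f x)) := by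
  rw [diffQuot, if_pos hx]
  have hs := (hf.hasStrictFDerivAt one_ne_zero).isLittleO
  have hr : refl α x = x := by rw [refl_apply, hx]; simp
  have ht : Tendsto (fun z => (z, refl α z)) (𝓝[{z | ⟪α, z⟫ ≠ 0}] x) (𝓝 (x, x)) := by
    have : ContinuousAt (fun z => (z, refl α z)) x := by fun_prop
    have h2 := this.tendsto
    simp only [hr] at h2
    exact h2.mono_left nhdsWithin_le_nhds
  have h1 := hs.comp_tendsto ht
  have h2 : (fun z => z - refl α z) =O[𝓝[{z | ⟪α, z⟫ ≠ 0}] x] fun z => ⟪α, z⟫ := by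
    refine IsBigO.of_bound ‖(2 / ⟪α, α⟫) • α‖ (Eventually.of_forall fun z => ?_)
    rw [refl_apply, sub_sub_cancel, norm_smul, norm_smul, norm_div, norm_mul, norm_div]
    apply le_of_eq
    ring
  have h3 := h1.trans_isBigO h2
  have h4 := (isLittleO_iff_tendsto' ?_).1 h3.norm_left
  swap
  · filter_upwards [self_mem_nhdsWithin] with z hz h
    exact absurd h hz
  rw [tendsto_iff_norm_sub_tendsto_zero]
  have h5 := h4.norm
  rw [norm_zero] at h5
  refine h5.congr' ?_
  filter_upwards [self_mem_nhdsWithin] with z hz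
  have hz' : ⟪α, z⟫ ≠ 0 := hz
  simp only [Function.comp]
  rw [norm_div, norm_norm, div_eq_inv_mul, ← norm_inv, ← norm_smul, smul_sub]
  congr 2
  rw [refl_apply, sub_sub_cancel, map_smul, smul_smul]
  congr 1
  field_simp

end Dunkl

end

namespace Dunkl

/-! ### The weight, its smooth regularisation, and invariance under reflections -/

section Weight

variable {d : ℕ} {R P : Finset (EuclideanSpace ℝ (Fin d))} {κ : EuclideanSpace ℝ (Fin d) → ℝ}

/-! The n-th Pizzetti term is exactly the weighted spherical mean of the Taylor component of degree
2n of f at 0 (`pizzettiTerm_eq`). Components of odd degree have mean zero because the weight is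
even, so both claims follow by integrating the Taylor expansion over the sphere: with the integral
remainder in the smooth case, term by term in the analytic case.

The identity is proved by duality, without intertwining operators or Dunkl harmonics. Dunkl
operators are antisymmetric for h_κ² dx (`integral_weight_dunklOp`), so Δ_κ is symmetric. Let φ be a
smooth radial bump and M = ∫ h_κ² φ. Moving Δ_κ^n from f(t·) to φ gives t^{2n} ∫ h_κ² φ (Δ_κ^n
f)(tx) dx = ∫ h_κ² (Δ_κ^n φ)(x) f(tx) dx. Divide by t^{2n} and let t → 0. The left side tends to M
(Δ_κ^n f)(0); on the right, Taylor components of degree below 2n pair to zero with Δ_κ^n φ, and the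
remainder is O(t). Hence M (Δ_κ^n f)(0) = ∫ h_κ² (Δ_κ^n φ) p, where p is the component of degree 2n
(`bumpMass_smul_laplacian_iterate`).

Since Δ_κ preserves radial functions, polar coordinates turn the last integral into c ∫_{S^{d-1}}
h_κ² p dσ, with c independent of f. Testing on ‖x‖^{2n}, whose n-th Laplacian is the constant 4^n n!
(λ_κ+1)_n, gives c ω_{κ,d} = M 4^n n! (λ_κ+1)_n, and c is eliminated
(`omega_smul_laplacian_iterate`). -/

theorem refl_refl (α x : EuclideanSpace ℝ (Fin d)) : refl α (refl α x) = x :=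
  Submodule.reflection_reflection _ x

theorem inner_refl (α β x : EuclideanSpace ℝ (Fin d)) : ⟪β, refl α x⟫ = ⟪refl α β, x⟫ := by
  rw [← (refl α).inner_map_map (refl α β) x, refl_refl]

theorem refl_self (α : EuclideanSpace ℝ (Fin d)) : refl α α = -α := by
  rw [refl]
  exact Submodule.reflection_orthogonalComplement_singleton_eq_neg α

theorem inner_self_refl (α x : EuclideanSpace ℝ (Fin d)) : ⟪α, refl α x⟫ = -⟪α, x⟫ := by
  rw [inner_refl, refl_self, inner_neg_left]

theorem IsPositiveSystem.subset (hP : IsPositiveSystem R P) : P ⊆ R := by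
  obtain ⟨β, -, h⟩ := hP
  exact fun α hα => ((h α).1 hα).1

theorem refl_mem_reflectionGroup {α : EuclideanSpace ℝ (Fin d)} (hα : α ∈ R) :
    refl α ∈ reflectionGroup R :=
  Subgroup.subset_closure ⟨α, hα, rfl⟩

theorem IsReducedRootSystem.neg_mem (hR : IsReducedRootSystem R) {α : EuclideanSpace ℝ (Fin d)}
    (hα : α ∈ R) : -α ∈ R := by
  rw [← refl_self]
  exact hR.refl_mem α hα α hα

theorem IsMultiplicity.neg (hκ : IsMultiplicity R κ) {α : EuclideanSpace ℝ (Fin d)}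
    (hα : α ∈ R) : κ (-α) = κ α := by
  rw [← refl_self]
  exact hκ.invariant _ (refl_mem_reflectionGroup hα) α hα

/-- A product over all roots of an even function is the square of the product over the positive
roots. -/
theorem prod_roots_eq_sq (hR : IsReducedRootSystem R) (hP : IsPositiveSystem R P)
    (u : EuclideanSpace ℝ (Fin d) → ℝ) (hu : ∀ α ∈ R, u (-α) = u α) :
    ∏ α ∈ R, u α = (∏ α ∈ P, u α) ^ 2 := by
  classical
  obtain ⟨β, hβ, h⟩ := hP
  have h1 : P = R.filter (fun α => 0 < ⟪α, β⟫) := by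
    ext α; simp [h]
  rw [← Finset.prod_filter_mul_prod_filter_not R (fun α => 0 < ⟪α, β⟫), ← h1, sq]
  congr 1
  refine Finset.prod_bij' (fun α _ => -α) (fun α _ => -α) ?_ ?_ ?_ ?_ ?_
  · intro α hα
    rw [Finset.mem_filter, not_lt] at hα
    rw [h, inner_neg_left]
    exact ⟨hR.neg_mem hα.1, by linarith [lt_of_le_of_ne hα.2 (hβ α hα.1)]⟩
  · intro α hα
    rw [h] at hα
    rw [Finset.mem_filter, inner_neg_left]
    exact ⟨hR.neg_mem hα.1, by linarith⟩
  · simp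
  · simp
  · intro α hα
    exact (hu α (Finset.mem_filter.1 hα).1).symm

/-- The regularised weight `∏_{α ∈ R_+} (⟨α, x⟩² + ε)^{κ_α}`, which is smooth for `ε > 0`. -/
noncomputable def regWeight (P : Finset (EuclideanSpace ℝ (Fin d)))
    (κ : EuclideanSpace ℝ (Fin d) → ℝ) (ε : ℝ) (x : EuclideanSpace ℝ (Fin d)) : ℝ :=
  ∏ α ∈ P, (⟪α, x⟫ ^ 2 + ε) ^ κ α

theorem regWeight_nonneg {ε : ℝ} (hε : 0 ≤ ε) (x : EuclideanSpace ℝ (Fin d)) :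
    0 ≤ regWeight P κ ε x :=
  Finset.prod_nonneg fun _ _ => by positivity

theorem regWeight_zero (x : EuclideanSpace ℝ (Fin d)) :
    regWeight P κ 0 x = weight P κ x ^ 2 := by
  rw [regWeight, weight, ← Finset.prod_pow]
  refine Finset.prod_congr rfl fun α _ => ?_
  rw [add_zero, ← sq_abs, ← Real.rpow_natCast, ← Real.rpow_natCast, ← Real.rpow_mul (abs_nonneg _),
    ← Real.rpow_mul (abs_nonneg _), mul_comm]

theorem continuous_regWeight (hκ : ∀ α ∈ P, 0 ≤ κ α) :
    Continuous fun p : ℝ × EuclideanSpace ℝ (Fin d) => regWeight P κ p.1 p.2 := by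
  refine continuous_finsetProd _ fun α hα => ?_
  exact Continuous.rpow_const (by fun_prop) fun _ => Or.inr (hκ α hα)

theorem continuous_weight_sq (hκ : ∀ α ∈ P, 0 ≤ κ α) :
    Continuous fun x : EuclideanSpace ℝ (Fin d) => weight P κ x ^ 2 := by
  have h := (continuous_regWeight hκ).comp (Continuous.prodMk (continuous_const (y := (0 : ℝ)))
    (continuous_id (X := EuclideanSpace ℝ (Fin d))))
  exact h.congr fun x => regWeight_zero x

theorem regWeight_mono (hκ : ∀ α ∈ P, 0 ≤ κ α) {ε δ : ℝ} (hε : 0 ≤ ε) (h : ε ≤ δ)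
    (x : EuclideanSpace ℝ (Fin d)) : regWeight P κ ε x ≤ regWeight P κ δ x :=
  Finset.prod_le_prod (fun _ _ => by positivity) fun α hα =>
    Real.rpow_le_rpow (by positivity) (by linarith) (hκ α hα)

/-- A reflection need not preserve the positive system, but it permutes R and κ is invariant. The
square of the regularised weight is the product over all of R, hence invariant; non-negativity
allows the square to be removed. -/
theorem regWeight_refl (hR : IsReducedRootSystem R) (hP : IsPositiveSystem R P)
    (hκ : IsMultiplicity R κ) {ε : ℝ} (hε : 0 ≤ ε) {α : EuclideanSpace ℝ (Fin d)} (hα : α ∈ R)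
    (x : EuclideanSpace ℝ (Fin d)) : regWeight P κ ε (refl α x) = regWeight P κ ε x := by
  have key : ∀ y, ∏ β ∈ R, (⟪β, y⟫ ^ 2 + ε) ^ κ β = regWeight P κ ε y ^ 2 := fun y => by
    rw [regWeight, ← prod_roots_eq_sq hR hP]
    intro β hβ
    rw [hκ.neg hβ, inner_neg_left, neg_sq]
  rw [← sq_eq_sq₀ (regWeight_nonneg hε _) (regWeight_nonneg hε _), ← key, ← key]
  refine Finset.prod_bij' (fun β _ => refl α β) (fun β _ => refl α β)
    (fun β hβ => hR.refl_mem α hα β hβ) (fun β hβ => hR.refl_mem α hα β hβ)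
    (fun β _ => refl_refl α β) (fun β _ => refl_refl α β) ?_
  intro β hβ
  rw [inner_refl, hκ.invariant _ (refl_mem_reflectionGroup hα) β hβ]

theorem weight_sq_neg (x : EuclideanSpace ℝ (Fin d)) :
    weight P κ (-x) ^ 2 = weight P κ x ^ 2 := by
  simp [weight]

theorem weight_sq_smul {r : ℝ} (hr : 0 < r) (x : EuclideanSpace ℝ (Fin d)) :
    weight P κ (r • x) ^ 2 = r ^ (2 * ∑ α ∈ P, κ α) * weight P κ x ^ 2 := by
  have h : weight P κ (r • x) = r ^ (∑ α ∈ P, κ α) * weight P κ x := by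
    rw [weight, weight, Real.rpow_sum_of_pos hr, ← Finset.prod_mul_distrib]
    refine Finset.prod_congr rfl fun α _ => ?_
    rw [real_inner_smul_right, abs_mul, abs_of_pos hr, Real.mul_rpow hr.le (abs_nonneg _)]
  rw [h, mul_pow, mul_comm 2, Real.rpow_mul hr.le, Real.rpow_two]

theorem omega_pos (hd : 0 < d) (hP : IsPositiveSystem R P) (hκ : ∀ α ∈ P, 0 ≤ κ α) :
    0 < omega P κ := by
  have hc : Continuous fun y : Metric.sphere (0 : EuclideanSpace ℝ (Fin d)) 1 =>
      weight P κ (y : EuclideanSpace ℝ (Fin d)) ^ 2 :=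
    (continuous_weight_sq hκ).comp continuous_subtype_val
  have : Nonempty (Fin d) := ⟨⟨0, hd⟩⟩
  obtain ⟨y, hy⟩ : ∃ y : Metric.sphere (0 : EuclideanSpace ℝ (Fin d)) 1,
      ∀ α ∈ P, ⟪α, (y : EuclideanSpace ℝ (Fin d))⟫ ≠ 0 := by
    -- The vector β that defines the positive system is orthogonal to no root, so its normalisation
    -- serves as the point. If β = 0 there are no roots at all, and any point of the sphere will do.
    have hR := hP.subset
    obtain ⟨β, hβ, h⟩ := hP
    rcases eq_or_ne β 0 with rfl | hβ0
    · obtain ⟨y, hy⟩ := (NormedSpace.sphere_nonempty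
        (E := EuclideanSpace ℝ (Fin d)) (x := 0) (r := 1)).2 zero_le_one
      refine ⟨⟨y, hy⟩, fun α hα => ?_⟩
      exact absurd (inner_zero_right α) (hβ α (hR hα))
    · refine ⟨⟨‖β‖⁻¹ • β, by simp [norm_smul, hβ0]⟩, fun α hα => ?_⟩
      rw [real_inner_smul_right]
      exact mul_ne_zero (by simpa using hβ0) (hβ α (hR hα))
  have : (surface d).IsOpenPosMeasure := by unfold surface; infer_instance
  have : IsFiniteMeasure (surface d) := by unfold surface; infer_instance
  refine hc.integral_pos_of_hasCompactSupport_nonneg_nonzero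
    (HasCompactSupport.of_compactSpace _) (fun _ => sq_nonneg _) (x := y) ?_
  refine pow_ne_zero 2 (Finset.prod_ne_zero_iff.2 fun α hα => ?_)
  exact (Real.rpow_pos_of_pos (abs_pos.2 (hy α hα)) _).ne'

end Weight

/-! ### Dunkl operators preserve smoothness -/

section Smoothness

universe u

variable {d : ℕ}

/-- Differentiating under the integral sign produces an integral of the same shape, with h replaced
by its derivative and A t by the operator T ↦ A t ∘ T ∘ L t. The spaces F and G and the family A are
quantified inside the induction so that it applies to this new integral. -/
theorem contDiff_integral_clm_comp (n : ℕ) :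
    ∀ {F G : Type u} [NormedAddCommGroup F] [NormedSpace ℝ F] [NormedAddCommGroup G]
      [NormedSpace ℝ G] {A : ℝ → F →L[ℝ] G}
      {L : ℝ → EuclideanSpace ℝ (Fin d) →L[ℝ] EuclideanSpace ℝ (Fin d)}
      {h : EuclideanSpace ℝ (Fin d) → F}, Continuous A → Continuous L → ContDiff ℝ n h →
      ContDiff ℝ n fun x => ∫ t in (0 : ℝ)..1, A t (h (L t x)) := by
  induction n with
  | zero =>
    intro F G _ _ _ _ A L h hA hL hh
    have hc := hh.continuous
    rw [Nat.cast_zero, contDiff_zero]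
    exact intervalIntegral.continuous_parametric_intervalIntegral_of_continuous'
      (by fun_prop) 0 1
  | succ n ih =>
    intro F G _ _ _ _ A L h hA hL hh
    have hc := hh.continuous
    have hh' : ContDiff ℝ n (fderiv ℝ h) := hh.fderiv_right (by norm_cast)
    have hc' := hh'.continuous
    set A' : ℝ → (EuclideanSpace ℝ (Fin d) →L[ℝ] F) →L[ℝ] (EuclideanSpace ℝ (Fin d) →L[ℝ] G) :=
      fun t => (ContinuousLinearMap.compL ℝ (EuclideanSpace ℝ (Fin d)) F G (A t)).comp
        ((ContinuousLinearMap.compL ℝ (EuclideanSpace ℝ (Fin d)) (EuclideanSpace ℝ (Fin d))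
          F).flip (L t)) with hA'
    have hA'c : Continuous A' := by fun_prop
    rw [Nat.cast_add, Nat.cast_one]
    refine contDiff_succ_iff_hasFDerivAt.2
      ⟨fun x => ∫ t in (0 : ℝ)..1, A' t (fderiv ℝ h (L t x)), ih hA'c hL hh', fun x₀ => ?_⟩
    have hj : Continuous fun p : ℝ × EuclideanSpace ℝ (Fin d) =>
        A' p.1 (fderiv ℝ h (L p.1 p.2)) := by fun_prop
    obtain ⟨C, hC⟩ := (isCompact_Icc.prod (isCompact_closedBall x₀ 1)).exists_bound_of_continuousOn
      (s := Set.Icc (0 : ℝ) 1 ×ˢ Metric.closedBall x₀ 1) hj.continuousOn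
    refine intervalIntegral.hasFDerivAt_integral_of_dominated_of_fderiv_le (bound := fun _ => C)
      (F' := fun x t => A' t (fderiv ℝ h (L t x)))
      (Metric.ball_mem_nhds x₀ one_pos) ?_ ?_ ?_ ?_ ?_ ?_
    · refine Eventually.of_forall fun x => Continuous.aestronglyMeasurable ?_
      fun_prop
    · refine Continuous.intervalIntegrable ?_ _ _
      fun_prop
    -- The operator space need not be separable; strong measurability comes from the second
    -- countability of the source ℝ.
    · have : SecondCountableTopologyEither ℝ (EuclideanSpace ℝ (Fin d) →L[ℝ] G) :=
        secondCountableTopologyEither_of_left _ _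
      exact (hj.comp (Continuous.prodMk_left x₀)).aestronglyMeasurable
    · refine Eventually.of_forall fun t ht x hx => ?_
      rw [Set.uIoc_of_le zero_le_one] at ht
      exact hC (t, x) ⟨⟨ht.1.le, ht.2⟩, Metric.ball_subset_closedBall hx⟩
    · exact intervalIntegrable_const
    · refine Eventually.of_forall fun t _ x _ => ?_
      have h1 : HasFDerivAt h (fderiv ℝ h (L t x)) (L t x) :=
        (hh.differentiable (by norm_cast) _).hasFDerivAt
      exact (A t).hasFDerivAt.comp x (h1.comp x (L t).hasFDerivAt)

variable {F : Type u} [NormedAddCommGroup F] [NormedSpace ℝ F]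

/-- The fundamental theorem of calculus on the segment from x to its mirror image. On the hyperplane
the segment degenerates and the integrand is constant, so one formula covers both branches and
smoothness can be read off across the hyperplane. -/
theorem diffQuot_eq_integral [CompleteSpace F] {α : EuclideanSpace ℝ (Fin d)}
    {f : EuclideanSpace ℝ (Fin d) → F} (hf : ContDiff ℝ 1 f) (x : EuclideanSpace ℝ (Fin d)) :
    diffQuot α f x =
      (2 / ⟪α, α⟫) • ∫ t in (0 : ℝ)..1, fderiv ℝ f (x - (t * (2 * ⟪α, x⟫ / ⟪α, α⟫)) • α) α := by
  rw [diffQuot]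
  split_ifs with hx
  · simp [hx]
  · set c := 2 * ⟪α, x⟫ / ⟪α, α⟫ with hc
    have h1 : ∀ t ∈ Set.uIcc (0 : ℝ) 1, HasDerivAt (fun t : ℝ => f (x - (t * c) • α))
        ((-c) • fderiv ℝ f (x - (t * c) • α) α) t := fun t _ => by
      have h2 : HasDerivAt (fun t : ℝ => x - (t * c) • α) (-((1 * c) • α)) t :=
        ((((hasDerivAt_id t).mul_const c).smul_const α)).const_sub x
      have h3 := ((hf.differentiable one_ne_zero _).hasFDerivAt.comp_hasDerivAt t h2)
      simpa [Function.comp_def] using h3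
    have hcf := hf.continuous_fderiv one_ne_zero
    have h4 := intervalIntegral.integral_eq_sub_of_hasDerivAt h1
      (Continuous.intervalIntegrable (by fun_prop) _ _)
    rw [intervalIntegral.integral_smul] at h4
    simp only [one_mul, zero_mul, zero_smul, sub_zero] at h4
    rw [refl_apply, ← hc, ← neg_sub, ← h4, neg_smul, neg_neg, smul_smul]
    congr 1
    rw [hc]
    field_simp

theorem contDiff_diffQuot [CompleteSpace F] (α : EuclideanSpace ℝ (Fin d))
    {f : EuclideanSpace ℝ (Fin d) → F} (hf : ContDiff ℝ ∞ f) : ContDiff ℝ ∞ (diffQuot α f) := by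
  rw [contDiff_infty]
  intro n
  have h1 : ContDiff ℝ n (fderiv ℝ f) := hf.fderiv_right (by exact_mod_cast le_top)
  rw [funext (diffQuot_eq_integral (α := α) (hf.of_le (by exact_mod_cast le_top)))]
  have h2 := contDiff_integral_clm_comp (d := d) n
    (A := fun _ => ContinuousLinearMap.apply ℝ F α)
    (L := fun t => ContinuousLinearMap.id ℝ _ -
      (t * (2 / ⟪α, α⟫)) • (innerSL ℝ α).smulRight α)
    continuous_const (by fun_prop) h1
  have h3 := h2.const_smul (2 / ⟪α, α⟫)
  convert h3 using 1
  ext x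
  simp only
  congr 2
  ext t
  simp only [ContinuousLinearMap.apply_apply, sub_apply, ContinuousLinearMap.id_apply,
    smul_apply, ContinuousLinearMap.smulRight_apply, innerSL_apply_apply, smul_smul]
  congr 4
  ring

theorem contDiff_dunklOp [CompleteSpace F] (P : Finset (EuclideanSpace ℝ (Fin d)))
    (κ : EuclideanSpace ℝ (Fin d) → ℝ) (ξ : EuclideanSpace ℝ (Fin d))
    {f : EuclideanSpace ℝ (Fin d) → F} (hf : ContDiff ℝ ∞ f) :
    ContDiff ℝ ∞ (dunklOp P κ ξ f) := by
  refine ContDiff.add ?_ (ContDiff.sum fun α _ => contDiff_const.smul (contDiff_diffQuot α hf))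
  exact (hf.fderiv_right (m := ∞) le_rfl).clm_apply contDiff_const

theorem contDiff_laplacian [CompleteSpace F] (P : Finset (EuclideanSpace ℝ (Fin d)))
    (κ : EuclideanSpace ℝ (Fin d) → ℝ)
    {f : EuclideanSpace ℝ (Fin d) → F} (hf : ContDiff ℝ ∞ f) :
    ContDiff ℝ ∞ (laplacian P κ f) :=
  ContDiff.sum fun _ _ => contDiff_dunklOp P κ _ (contDiff_dunklOp P κ _ hf)

theorem contDiff_laplacian_iterate [CompleteSpace F] (P : Finset (EuclideanSpace ℝ (Fin d)))
    (κ : EuclideanSpace ℝ (Fin d) → ℝ)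
    {f : EuclideanSpace ℝ (Fin d) → F} (hf : ContDiff ℝ ∞ f) (n : ℕ) :
    ContDiff ℝ ∞ ((laplacian P κ)^[n] f) := by
  induction n with
  | zero => exact hf
  | succ n ih =>
    rw [Function.iterate_succ_apply']
    exact contDiff_laplacian P κ ih

end Smoothness

/-! ### Behaviour under dilations -/

section Scaling

variable {d : ℕ} {F : Type*} [NormedAddCommGroup F] [NormedSpace ℝ F]
  (P : Finset (EuclideanSpace ℝ (Fin d))) (κ : EuclideanSpace ℝ (Fin d) → ℝ)

/-- Reflections are linear, so they commute with dilations, and both the derivative and the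
difference quotient gain one factor t. The scaling rule for `fderiv` needs no differentiability,
hence neither does this one. -/
theorem dunklOp_comp_smul (ξ : EuclideanSpace ℝ (Fin d)) (f : EuclideanSpace ℝ (Fin d) → F)
    {t : ℝ} (ht : t ≠ 0) :
    dunklOp P κ ξ (fun x => f (t • x)) = fun x => t • dunklOp P κ ξ f (t • x) := by
  ext x
  rw [dunklOp, dunklOp, fderiv_comp_smul, smul_add, smul_apply, Finset.smul_sum]
  congr 1
  refine Finset.sum_congr rfl fun α _ => ?_
  rw [smul_comm]
  congr 1
  rw [diffQuot, diffQuot, real_inner_smul_right, map_smul, fderiv_comp_smul, smul_apply, smul_ite]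
  refine if_congr (by simp [ht]) (smul_comm _ _ _) ?_
  rw [smul_smul, mul_inv, mul_inv_cancel_left₀ ht]

theorem dunklOp_const_smul (ξ : EuclideanSpace ℝ (Fin d)) (f : EuclideanSpace ℝ (Fin d) → F)
    (c : ℝ) : dunklOp P κ ξ (fun x => c • f x) = fun x => c • dunklOp P κ ξ f x := by
  have h : fderiv ℝ (fun x => c • f x) = fun x => c • fderiv ℝ f x := fderiv_const_smul_field c
  ext x
  rw [dunklOp, dunklOp, h, smul_add, smul_apply, Finset.smul_sum]
  congr 1
  refine Finset.sum_congr rfl fun α _ => ?_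
  rw [smul_comm]
  congr 1
  rw [diffQuot, diffQuot, h, smul_apply, smul_ite, ← smul_sub, smul_comm c, smul_comm c]

theorem laplacian_comp_smul (f : EuclideanSpace ℝ (Fin d) → F) {t : ℝ} (ht : t ≠ 0) :
    laplacian P κ (fun x => f (t • x)) = fun x => t ^ 2 • laplacian P κ f (t • x) := by
  ext x
  simp only [laplacian]
  rw [Finset.smul_sum]
  refine Finset.sum_congr rfl fun j _ => ?_
  rw [dunklOp_comp_smul P κ _ f ht, dunklOp_const_smul, dunklOp_comp_smul P κ _ _ ht, sq]
  exact smul_smul _ _ _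

theorem laplacian_const_smul (f : EuclideanSpace ℝ (Fin d) → F) (c : ℝ) :
    laplacian P κ (fun x => c • f x) = fun x => c • laplacian P κ f x := by
  ext x
  simp only [laplacian]
  rw [Finset.smul_sum]
  refine Finset.sum_congr rfl fun j _ => ?_
  rw [dunklOp_const_smul, dunklOp_const_smul]

theorem laplacian_iterate_comp_smul (f : EuclideanSpace ℝ (Fin d) → F) {t : ℝ} (ht : t ≠ 0)
    (n : ℕ) :
    (laplacian P κ)^[n] (fun x => f (t • x)) =
      fun x => t ^ (2 * n) • (laplacian P κ)^[n] f (t • x) := by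
  induction n with
  | zero => simp
  | succ n ih =>
    rw [Function.iterate_succ_apply', ih, laplacian_const_smul, laplacian_comp_smul P κ _ ht,
      Function.iterate_succ_apply']
    ext x
    rw [smul_smul]
    congr 1
    ring

end Scaling

/-! ### Dependence on values in balls around the origin -/

section Locality

variable {d : ℕ} {F : Type*} [NormedAddCommGroup F] [NormedSpace ℝ F]
  (P : Finset (EuclideanSpace ℝ (Fin d))) (κ : EuclideanSpace ℝ (Fin d) → ℝ)

/-- Dunkl operators are not local, since they involve values at mirror images; but reflections are
isometries fixing 0, so balls centred at 0 are preserved. -/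
theorem dunklOp_eqOn_ball (ξ : EuclideanSpace ℝ (Fin d)) {f g : EuclideanSpace ℝ (Fin d) → F}
    {ρ : ℝ} (h : Set.EqOn f g (Metric.ball 0 ρ)) :
    Set.EqOn (dunklOp P κ ξ f) (dunklOp P κ ξ g) (Metric.ball 0 ρ) := by
  intro x hx
  have h1 : fderiv ℝ f x = fderiv ℝ g x :=
    (h.eventuallyEq_of_mem (Metric.isOpen_ball.mem_nhds hx)).fderiv_eq
  simp only [dunklOp, diffQuot, h1]
  congr 1
  refine Finset.sum_congr rfl fun α _ => ?_
  rw [h hx, h (x := refl α x) (by simpa using hx)]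

theorem laplacian_eqOn_ball {f g : EuclideanSpace ℝ (Fin d) → F}
    {ρ : ℝ} (h : Set.EqOn f g (Metric.ball 0 ρ)) :
    Set.EqOn (laplacian P κ f) (laplacian P κ g) (Metric.ball 0 ρ) := fun _ hx =>
  Finset.sum_congr rfl fun _ _ => dunklOp_eqOn_ball P κ _ (dunklOp_eqOn_ball P κ _ h) hx

theorem laplacian_iterate_eqOn_ball {f g : EuclideanSpace ℝ (Fin d) → F}
    {ρ : ℝ} (h : Set.EqOn f g (Metric.ball 0 ρ)) (n : ℕ) :
    Set.EqOn ((laplacian P κ)^[n] f) ((laplacian P κ)^[n] g) (Metric.ball 0 ρ) := by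
  induction n with
  | zero => exact h
  | succ n ih =>
    rw [Function.iterate_succ_apply', Function.iterate_succ_apply']
    exact laplacian_eqOn_ball P κ ih

end Locality

/-! ### Compact support, tracked by balls around 0 since these are stable under reflections -/

section CompactSupport

variable {d : ℕ} {F : Type*} [NormedAddCommGroup F]

theorem exists_radius_of_hasCompactSupport {f : EuclideanSpace ℝ (Fin d) → F}
    (hf : HasCompactSupport f) : ∃ ρ : ℝ, ∀ x, ρ < ‖x‖ → f x = 0 := by
  obtain ⟨ρ, hρ⟩ := (hf.isCompact.isBounded).subset_closedBall 0
  refine ⟨ρ, fun x hx => image_eq_zero_of_notMem_tsupport fun h => ?_⟩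
  have := hρ h
  rw [mem_closedBall_zero_iff] at this
  linarith

theorem hasCompactSupport_of_radius {f : EuclideanSpace ℝ (Fin d) → F} {ρ : ℝ}
    (h : ∀ x, ρ < ‖x‖ → f x = 0) : HasCompactSupport f :=
  HasCompactSupport.intro (isCompact_closedBall 0 ρ) fun x hx =>
    h x (by simpa using hx)

variable [NormedSpace ℝ F]

theorem fderiv_eq_zero_of_radius {f : EuclideanSpace ℝ (Fin d) → F} {ρ : ℝ}
    (h : ∀ x, ρ < ‖x‖ → f x = 0) {x : EuclideanSpace ℝ (Fin d)} (hx : ρ < ‖x‖) :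
    fderiv ℝ f x = 0 := by
  have h1 : f =ᶠ[𝓝 x] fun _ => 0 := by
    filter_upwards [(isOpen_lt continuous_const continuous_norm).mem_nhds hx] with y hy
    exact h y hy
  rw [h1.fderiv_eq, fderiv_fun_const, Pi.zero_apply]

theorem diffQuot_eq_zero_of_radius {f : EuclideanSpace ℝ (Fin d) → F} {ρ : ℝ}
    (h : ∀ x, ρ < ‖x‖ → f x = 0) (α : EuclideanSpace ℝ (Fin d))
    {x : EuclideanSpace ℝ (Fin d)} (hx : ρ < ‖x‖) : diffQuot α f x = 0 := by
  rw [diffQuot, fderiv_eq_zero_of_radius h hx, h x hx, h (refl α x) (by simpa using hx)]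
  simp

theorem dunklOp_eq_zero_of_radius {f : EuclideanSpace ℝ (Fin d) → F} {ρ : ℝ}
    (h : ∀ x, ρ < ‖x‖ → f x = 0) (P : Finset (EuclideanSpace ℝ (Fin d)))
    (κ : EuclideanSpace ℝ (Fin d) → ℝ) (ξ : EuclideanSpace ℝ (Fin d))
    {x : EuclideanSpace ℝ (Fin d)} (hx : ρ < ‖x‖) : dunklOp P κ ξ f x = 0 := by
  simp [dunklOp, fderiv_eq_zero_of_radius h hx, diffQuot_eq_zero_of_radius h _ hx]

theorem laplacian_eq_zero_of_radius {f : EuclideanSpace ℝ (Fin d) → F} {ρ : ℝ}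
    (h : ∀ x, ρ < ‖x‖ → f x = 0) (P : Finset (EuclideanSpace ℝ (Fin d)))
    (κ : EuclideanSpace ℝ (Fin d) → ℝ)
    {x : EuclideanSpace ℝ (Fin d)} (hx : ρ < ‖x‖) : laplacian P κ f x = 0 :=
  Finset.sum_eq_zero fun _ _ => dunklOp_eq_zero_of_radius
    (fun _ hy => dunklOp_eq_zero_of_radius h P κ _ hy) P κ _ hx

theorem hasCompactSupport_diffQuot {f : EuclideanSpace ℝ (Fin d) → F} (hf : HasCompactSupport f)
    (α : EuclideanSpace ℝ (Fin d)) : HasCompactSupport (diffQuot α f) := by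
  obtain ⟨ρ, h⟩ := exists_radius_of_hasCompactSupport hf
  exact hasCompactSupport_of_radius fun x hx => diffQuot_eq_zero_of_radius h α hx

theorem hasCompactSupport_dunklOp {f : EuclideanSpace ℝ (Fin d) → F} (hf : HasCompactSupport f)
    (P : Finset (EuclideanSpace ℝ (Fin d)))
    (κ : EuclideanSpace ℝ (Fin d) → ℝ) (ξ : EuclideanSpace ℝ (Fin d)) :
    HasCompactSupport (dunklOp P κ ξ f) := by
  obtain ⟨ρ, h⟩ := exists_radius_of_hasCompactSupport hf
  exact hasCompactSupport_of_radius fun x hx => dunklOp_eq_zero_of_radius h P κ ξ hx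

theorem hasCompactSupport_laplacian {f : EuclideanSpace ℝ (Fin d) → F} (hf : HasCompactSupport f)
    (P : Finset (EuclideanSpace ℝ (Fin d))) (κ : EuclideanSpace ℝ (Fin d) → ℝ) :
    HasCompactSupport (laplacian P κ f) := by
  obtain ⟨ρ, h⟩ := exists_radius_of_hasCompactSupport hf
  exact hasCompactSupport_of_radius fun x hx => laplacian_eq_zero_of_radius h P κ hx

end CompactSupport

/-! ### Antisymmetry of Dunkl operators and symmetry of the Laplacian -/

section IntegrationByParts

variable {d : ℕ} {F : Type*} [NormedAddCommGroup F] [NormedSpace ℝ F]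
  {R P : Finset (EuclideanSpace ℝ (Fin d))} {κ : EuclideanSpace ℝ (Fin d) → ℝ}

theorem integral_comp_refl (α : EuclideanSpace ℝ (Fin d)) (g : EuclideanSpace ℝ (Fin d) → F) :
    ∫ x, g (refl α x) = ∫ x, g x :=
  (refl α).measurePreserving.integral_comp (refl α).toHomeomorph.measurableEmbedding g

theorem integral_eq_zero_of_refl_odd {α : EuclideanSpace ℝ (Fin d)}
    {g : EuclideanSpace ℝ (Fin d) → F} (hg : ∀ x, g (refl α x) = -g x) : ∫ x, g x = 0 := by
  have h := integral_comp_refl α g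
  simp_rw [hg, integral_neg] at h
  have h2 : (2 : ℝ) • ∫ x, g x = 0 := by
    rw [two_smul]
    nth_rw 1 [← h]
    exact neg_add_cancel _
  exact (smul_eq_zero.1 h2).resolve_left two_ne_zero

theorem continuous_regWeight_right (hκ : ∀ α ∈ P, 0 ≤ κ α) (ε : ℝ) :
    Continuous (regWeight P κ ε) := by
  have h := (continuous_regWeight hκ).comp (Continuous.prodMk (continuous_const (y := ε))
    (continuous_id (X := EuclideanSpace ℝ (Fin d))))
  exact h

theorem hasFDerivAt_regWeight {ε : ℝ} (hε : 0 < ε) (x : EuclideanSpace ℝ (Fin d)) :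
    HasFDerivAt (regWeight P κ ε)
      (∑ α ∈ P, (2 * κ α * (⟪α, x⟫ / (⟪α, x⟫ ^ 2 + ε)) * regWeight P κ ε x) • innerSL ℝ α) x := by
  classical
  have h1 : ∀ α ∈ P, HasFDerivAt (fun x : EuclideanSpace ℝ (Fin d) => (⟪α, x⟫ ^ 2 + ε) ^ κ α)
      ((2 * κ α * (⟪α, x⟫ / (⟪α, x⟫ ^ 2 + ε)) * (⟪α, x⟫ ^ 2 + ε) ^ κ α) • innerSL ℝ α) x := by
    intro α _
    have h0 : HasFDerivAt (fun x : EuclideanSpace ℝ (Fin d) => ⟪α, x⟫) (innerSL ℝ α) x :=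
      (innerSL ℝ α).hasFDerivAt
    have hpos : 0 < ⟪α, x⟫ ^ 2 + ε := by positivity
    have h2 := ((h0.pow 2).add_const ε).rpow_const (p := κ α) (Or.inl hpos.ne')
    refine h2.congr_fderiv ?_
    rw [smul_smul, Real.rpow_sub_one hpos.ne']
    congr 1
    push_cast
    field_simp
    norm_num
    ring
  have h3 := HasFDerivAt.finsetProd (u := P) h1
  refine h3.congr_fderiv ?_
  symm
  refine Finset.sum_congr rfl fun α hα => ?_
  rw [smul_smul, regWeight, ← Finset.mul_prod_erase P _ hα]
  congr 1
  ring

theorem fderiv_regWeight_apply {ε : ℝ} (hε : 0 < ε) (x ξ : EuclideanSpace ℝ (Fin d)) :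
    fderiv ℝ (regWeight P κ ε) x ξ = ∑ α ∈ P, (κ α * ⟪α, ξ⟫) *
      (2 * (⟪α, x⟫ / (⟪α, x⟫ ^ 2 + ε)) * regWeight P κ ε x) := by
  rw [(hasFDerivAt_regWeight hε x).fderiv, sum_apply]
  refine Finset.sum_congr rfl fun α _ => ?_
  rw [smul_apply, innerSL_apply_apply, smul_eq_mul]
  ring

/-- The factor in front vanishes on the hyperplane, which removes the case distinction, and is
bounded by 1 for ε > 0. It replaces the singular 1/⟨α, x⟩ by ⟨α, x⟩/(⟨α, x⟩² + ε), the function that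
occurs in the logarithmic derivative of the regularised weight. -/
theorem smul_diffQuot_eq {ε : ℝ} (α x : EuclideanSpace ℝ (Fin d))
    (f : EuclideanSpace ℝ (Fin d) → F) :
    (⟪α, x⟫ ^ 2 / (⟪α, x⟫ ^ 2 + ε)) • diffQuot α f x =
      (⟪α, x⟫ / (⟪α, x⟫ ^ 2 + ε)) • (f x - f (refl α x)) := by
  rw [diffQuot]
  split_ifs with h
  · simp [h]
  · rw [smul_smul]
    congr 1
    field_simp

/-- Integrating the regularised difference part of the Dunkl operator by parts. -/
theorem integral_regWeight_diffQuot [CompleteSpace F] (hR : IsReducedRootSystem R)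
    (hP : IsPositiveSystem R P) (hκ : IsMultiplicity R κ) {ε : ℝ} (hε : 0 < ε)
    {α : EuclideanSpace ℝ (Fin d)} (hα : α ∈ R)
    {φ : EuclideanSpace ℝ (Fin d) → ℝ} {f : EuclideanSpace ℝ (Fin d) → F}
    (hφ : Continuous φ) (hφc : HasCompactSupport φ) (hf : Continuous f) :
    ∫ x, (2 * (⟪α, x⟫ / (⟪α, x⟫ ^ 2 + ε)) * regWeight P κ ε x) • φ x • f x =
      ∫ x, (regWeight P κ ε x * (⟪α, x⟫ ^ 2 / (⟪α, x⟫ ^ 2 + ε))) •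
        (φ x • diffQuot α f x + diffQuot α φ x • f x) := by
  have hκ' : ∀ α ∈ P, 0 ≤ κ α := fun α h => hκ.nonneg α (hP.subset h)
  have hWc := continuous_regWeight_right hκ' ε
  have hs : ∀ x, ⟪α, x⟫ ^ 2 + ε ≠ 0 := fun x => by positivity
  have hqc : Continuous fun x => ⟪α, x⟫ / (⟪α, x⟫ ^ 2 + ε) :=
    Continuous.div (by fun_prop) (by fun_prop) hs
  set u : EuclideanSpace ℝ (Fin d) → ℝ :=
    fun x => ⟪α, x⟫ / (⟪α, x⟫ ^ 2 + ε) * regWeight P κ ε x with hu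
  have huc : Continuous u := hqc.mul hWc
  have hodd : ∀ x, u (refl α x) = -u x := fun x => by
    simp only [hu]
    rw [regWeight_refl hR hP hκ hε.le hα, inner_self_refl, neg_sq]
    ring
  have hφr : Continuous fun x => φ (refl α x) := hφ.comp (refl α).continuous
  have hfr : Continuous fun x => f (refl α x) := hf.comp (refl α).continuous
  have hφrc : HasCompactSupport fun x => φ (refl α x) :=
    hφc.comp_homeomorph (refl α).toHomeomorph
  -- The reflection exchanges the two summands of the bracket, while u changes sign; so the mixed
  -- terms integrate to zero and only the multiple of φ f survives.
  have h1 : ∫ x, u x • (φ x • f (refl α x) + φ (refl α x) • f x) = 0 :=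
    integral_eq_zero_of_refl_odd (α := α) fun x => by
      rw [hodd, refl_refl, neg_smul, add_comm]
  have h2 : ∀ x, (regWeight P κ ε x * (⟪α, x⟫ ^ 2 / (⟪α, x⟫ ^ 2 + ε))) •
        (φ x • diffQuot α f x + diffQuot α φ x • f x) =
      (2 * (⟪α, x⟫ / (⟪α, x⟫ ^ 2 + ε)) * regWeight P κ ε x) • φ x • f x -
        u x • (φ x • f (refl α x) + φ (refl α x) • f x) := fun x => by
    have e1 := smul_diffQuot_eq (ε := ε) α x f
    have e2 := smul_diffQuot_eq (ε := ε) α x φ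
    rw [smul_eq_mul, smul_eq_mul] at e2
    have e3 : (⟪α, x⟫ ^ 2 / (⟪α, x⟫ ^ 2 + ε)) • (φ x • diffQuot α f x + diffQuot α φ x • f x) =
        (⟪α, x⟫ / (⟪α, x⟫ ^ 2 + ε)) •
          (φ x • (f x - f (refl α x)) + (φ x - φ (refl α x)) • f x) := by
      rw [smul_add, smul_comm _ (φ x), e1, smul_smul _ _ (f x), e2, smul_add, smul_comm (φ x),
        mul_smul]
    rw [mul_smul, e3, hu]
    module
  simp_rw [h2]
  rw [integral_sub, h1, sub_zero]
  · exact Continuous.integrable_of_hasCompactSupport (by fun_prop)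
      ((hφc.smul_right (f' := f)).smul_left)
  · refine Continuous.integrable_of_hasCompactSupport (by fun_prop) (HasCompactSupport.smul_left ?_)
    exact (hφc.smul_right).add (hφrc.smul_right)

/-- Classical integration by parts, legitimate because the regularised weight is smooth. Its
derivative is a sum over roots, and each summand is rewritten by `integral_regWeight_diffQuot`. As ε
→ 0 this becomes ∫ h_κ² (φ D_ξ f + (D_ξ φ) f) = 0. -/
theorem integral_regWeight_fderiv [CompleteSpace F] (hR : IsReducedRootSystem R)
    (hP : IsPositiveSystem R P) (hκ : IsMultiplicity R κ) {ε : ℝ} (hε : 0 < ε)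
    (ξ : EuclideanSpace ℝ (Fin d))
    {φ : EuclideanSpace ℝ (Fin d) → ℝ} {f : EuclideanSpace ℝ (Fin d) → F}
    (hφ : ContDiff ℝ ∞ φ) (hφc : HasCompactSupport φ) (hf : ContDiff ℝ ∞ f) :
    (∫ x, regWeight P κ ε x • (φ x • fderiv ℝ f x ξ + fderiv ℝ φ x ξ • f x)) +
      ∑ α ∈ P, (κ α * ⟪α, ξ⟫) • ∫ x, (regWeight P κ ε x * (⟪α, x⟫ ^ 2 / (⟪α, x⟫ ^ 2 + ε))) •
        (φ x • diffQuot α f x + diffQuot α φ x • f x) = 0 := by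
  have hκ' : ∀ α ∈ P, 0 ≤ κ α := fun α h => hκ.nonneg α (hP.subset h)
  have hWc := continuous_regWeight_right hκ' ε
  have hd : ∀ x, fderiv ℝ (fun x => φ x • f x) x ξ = φ x • fderiv ℝ f x ξ + fderiv ℝ φ x ξ • f x := by
    intro x
    rw [fderiv_fun_smul (hφ.differentiable (by simp) x) (hf.differentiable (by simp) x)]
    simp
  have hfc := hf.continuous
  have hφ' := hφ.continuous
  have hf'c := hf.continuous_fderiv (by simp)
  have hφ'c := hφ.continuous_fderiv (by simp)
  have hcs : HasCompactSupport fun x => φ x • f x := hφc.smul_right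
  have hq : ∀ α : EuclideanSpace ℝ (Fin d),
      Continuous fun x : EuclideanSpace ℝ (Fin d) => ⟪α, x⟫ / (⟪α, x⟫ ^ 2 + ε) := fun α =>
    Continuous.div (by fun_prop) (by fun_prop) fun x => by positivity
  have hi : ∀ α ∈ P, Integrable (fun x =>
      (2 * (⟪α, x⟫ / (⟪α, x⟫ ^ 2 + ε)) * regWeight P κ ε x) • φ x • f x) := fun α _ => by
    have := hq α
    exact Continuous.integrable_of_hasCompactSupport (by fun_prop) hcs.smul_left
  have hWd : ∀ x, fderiv ℝ (regWeight P κ ε) x ξ • φ x • f x = ∑ α ∈ P, (κ α * ⟪α, ξ⟫) •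
      (2 * (⟪α, x⟫ / (⟪α, x⟫ ^ 2 + ε)) * regWeight P κ ε x) • φ x • f x := fun x => by
    rw [fderiv_regWeight_apply hε, Finset.sum_smul]
    exact Finset.sum_congr rfl fun α _ => mul_smul _ _ _
  have hi' : ∀ α ∈ P, Integrable (fun x => (κ α * ⟪α, ξ⟫) •
      (2 * (⟪α, x⟫ / (⟪α, x⟫ ^ 2 + ε)) * regWeight P κ ε x) • φ x • f x) :=
    fun α hα => (hi α hα).smul _
  have hWi : Integrable fun x => fderiv ℝ (regWeight P κ ε) x ξ • φ x • f x := by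
    simp_rw [hWd]
    exact integrable_finsetSum _ hi'
  have h1 := integral_smul_fderiv_eq_neg_fderiv_smul_of_integrable (μ := volume)
    (f := regWeight P κ ε) (g := fun x => φ x • f x) (v := ξ) hWi ?_ ?_
    (fun x _ => (hasFDerivAt_regWeight hε x).differentiableAt)
    (fun x _ => (hφ.smul hf).differentiable (by simp) x)
  · simp_rw [hd] at h1
    rw [h1, neg_add_eq_zero]
    simp_rw [hWd]
    rw [integral_finsetSum _ hi']
    refine Finset.sum_congr rfl fun α hα => ?_
    rw [integral_smul, integral_regWeight_diffQuot hR hP hκ hε (hP.subset hα) hφ' hφc hfc]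
  · simp_rw [hd]
    refine Continuous.integrable_of_hasCompactSupport (by fun_prop) (HasCompactSupport.smul_left ?_)
    refine (hφc.smul_right).add (HasCompactSupport.smul_right ?_)
    exact (hφc.fderiv (𝕜 := ℝ)).comp_left (g := fun L : EuclideanSpace ℝ (Fin d) →L[ℝ] ℝ => L ξ) rfl
  · exact Continuous.integrable_of_hasCompactSupport (by fun_prop) hcs.smul_left

theorem ae_inner_ne_zero {α : EuclideanSpace ℝ (Fin d)} (hα : α ≠ 0) :
    ∀ᵐ x : EuclideanSpace ℝ (Fin d), ⟪α, x⟫ ≠ 0 := by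
  have h := Measure.addHaar_submodule (volume : Measure (EuclideanSpace ℝ (Fin d)))
    (LinearMap.ker (innerSL ℝ α).toLinearMap) (fun h => ?_)
  · rw [ae_iff]
    convert h using 2
    ext x
    simp
  · have : α ∈ LinearMap.ker (innerSL ℝ α).toLinearMap := h ▸ Submodule.mem_top
    simp [hα] at this

/-- Dominated convergence: the regularised weight increases with ε, so its value at ε = 1 gives a
majorant. The factor θ accommodates both parts of the Dunkl operator: 1 for the derivative, ⟨α,
x⟩²/(⟨α, x⟩² + ε) for the differences. -/
theorem tendsto_integral_regWeight (hκ : ∀ α ∈ P, 0 ≤ κ α)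
    {θ : ℝ → EuclideanSpace ℝ (Fin d) → ℝ} (hθ0 : ∀ ε > 0, ∀ x, 0 ≤ θ ε x)
    (hθ1 : ∀ ε > 0, ∀ x, θ ε x ≤ 1) (hθc : ∀ ε > 0, Continuous (θ ε))
    (hθ : ∀ᵐ x, Tendsto (fun ε => θ ε x) (𝓝[>] 0) (𝓝 1))
    {u : EuclideanSpace ℝ (Fin d) → F} (hu : Continuous u) (huc : HasCompactSupport u) :
    Tendsto (fun ε => ∫ x, (regWeight P κ ε x * θ ε x) • u x) (𝓝[>] 0)
      (𝓝 (∫ x, (weight P κ x ^ 2) • u x)) := by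
  have hIoo : Set.Ioo (0 : ℝ) 1 ∈ 𝓝[>] (0 : ℝ) := Ioo_mem_nhdsGT one_pos
  have hW1 := continuous_regWeight_right hκ 1
  refine tendsto_integral_filter_of_dominated_convergence
    (fun x => ‖regWeight P κ 1 x • u x‖) ?_ ?_ ?_ ?_
  · filter_upwards [hIoo] with ε hε
    have h1 := hθc ε hε.1
    have h2 := continuous_regWeight_right hκ ε
    exact Continuous.aestronglyMeasurable (by fun_prop)
  · filter_upwards [hIoo] with ε hε
    refine Eventually.of_forall fun x => ?_
    rw [norm_smul, norm_smul]
    refine mul_le_mul_of_nonneg_right ?_ (norm_nonneg _)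
    have h1 := regWeight_nonneg (P := P) (κ := κ) hε.1.le x
    have h2 := regWeight_mono hκ hε.1.le hε.2.le x
    rw [Real.norm_of_nonneg (mul_nonneg h1 (hθ0 ε hε.1 x)), Real.norm_of_nonneg (h1.trans h2)]
    exact (mul_le_of_le_one_right h1 (hθ1 ε hε.1 x)).trans h2
  · exact (Continuous.integrable_of_hasCompactSupport (by fun_prop) huc.smul_left).norm
  · filter_upwards [hθ] with x hx
    have h1 : Tendsto (fun ε => regWeight P κ ε x) (𝓝[>] 0) (𝓝 (weight P κ x ^ 2)) := by
      rw [← regWeight_zero]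
      have h2 := (continuous_regWeight hκ).comp (Continuous.prodMk continuous_id
        (continuous_const (y := x)))
      exact (h2.tendsto 0).mono_left nhdsWithin_le_nhds
    simpa using (h1.mul hx).smul_const (u x)

/-- Dunkl operators are antisymmetric with respect to the weight `h_κ²`. -/
theorem integral_weight_dunklOp [CompleteSpace F] (hR : IsReducedRootSystem R)
    (hP : IsPositiveSystem R P) (hκ : IsMultiplicity R κ) (ξ : EuclideanSpace ℝ (Fin d))
    {φ : EuclideanSpace ℝ (Fin d) → ℝ} {f : EuclideanSpace ℝ (Fin d) → F}
    (hφ : ContDiff ℝ ∞ φ) (hφc : HasCompactSupport φ) (hf : ContDiff ℝ ∞ f) :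
    ∫ x, (weight P κ x ^ 2) • φ x • dunklOp P κ ξ f x =
      -∫ x, (weight P κ x ^ 2) • dunklOp P κ ξ φ x • f x := by
  have hκ' : ∀ α ∈ P, 0 ≤ κ α := fun α h => hκ.nonneg α (hP.subset h)
  have hw := continuous_weight_sq hκ'
  have hfc := hf.continuous
  have hφ' := hφ.continuous
  have hf'c := hf.continuous_fderiv (by simp)
  have hφ'c := hφ.continuous_fderiv (by simp)
  have hfq := fun α => (contDiff_diffQuot α hf).continuous
  have hφq := fun α => (contDiff_diffQuot α hφ).continuous
  set u₀ : EuclideanSpace ℝ (Fin d) → F :=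
    fun x => φ x • fderiv ℝ f x ξ + fderiv ℝ φ x ξ • f x with hu₀
  set u : EuclideanSpace ℝ (Fin d) → EuclideanSpace ℝ (Fin d) → F :=
    fun α x => φ x • diffQuot α f x + diffQuot α φ x • f x with hu
  have hu₀c : Continuous u₀ := by fun_prop
  have huc : ∀ α, Continuous (u α) := fun α => by
    have := hfq α
    have := hφq α
    fun_prop
  have hu₀s : HasCompactSupport u₀ := (hφc.smul_right).add (HasCompactSupport.smul_right
    ((hφc.fderiv (𝕜 := ℝ)).comp_left (g := fun L : EuclideanSpace ℝ (Fin d) →L[ℝ] ℝ => L ξ) rfl))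
  have hus : ∀ α, HasCompactSupport (u α) := fun α =>
    (hφc.smul_right).add (hasCompactSupport_diffQuot hφc α).smul_right
  have hlim₀ := tendsto_integral_regWeight hκ' (θ := fun _ _ => 1) (by simp) (by simp)
    (fun _ _ => continuous_const) (by simp) hu₀c hu₀s
  have hlim : ∀ α ∈ P, Tendsto (fun ε => (κ α * ⟪α, ξ⟫) •
      ∫ x, (regWeight P κ ε x * (⟪α, x⟫ ^ 2 / (⟪α, x⟫ ^ 2 + ε))) • u α x) (𝓝[>] 0)
      (𝓝 ((κ α * ⟪α, ξ⟫) • ∫ x, (weight P κ x ^ 2) • u α x)) := fun α hα => by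
    refine (tendsto_integral_regWeight hκ' (θ := fun ε x => ⟪α, x⟫ ^ 2 / (⟪α, x⟫ ^ 2 + ε))
      ?_ ?_ ?_ ?_ (huc α) (hus α)).const_smul _
    · intro ε hε x
      positivity
    · intro ε hε x
      exact div_le_one_of_le₀ (by linarith) (by positivity)
    · intro ε hε
      exact Continuous.div (by fun_prop) (by fun_prop) fun x => by positivity
    -- The factor tends to 1 only off the hyperplane α^⊥, which is a null set.
    · have hα0 : α ≠ 0 := fun h => hR.zero_notMem (h ▸ hP.subset hα)
      filter_upwards [ae_inner_ne_zero hα0] with x hx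
      have h1 : ContinuousAt (fun ε : ℝ => ⟪α, x⟫ ^ 2 / (⟪α, x⟫ ^ 2 + ε)) 0 :=
        ContinuousAt.div (by fun_prop) (by fun_prop) (by simpa using hx)
      have h2 := h1.tendsto
      rw [add_zero, div_self (pow_ne_zero 2 hx)] at h2
      exact h2.mono_left nhdsWithin_le_nhds
  have hsum := hlim₀.add (tendsto_finsetSum P hlim)
  have hzero : (∫ x, (weight P κ x ^ 2) • u₀ x) +
      ∑ α ∈ P, (κ α * ⟪α, ξ⟫) • ∫ x, (weight P κ x ^ 2) • u α x = 0 := by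
    refine tendsto_nhds_unique hsum (tendsto_const_nhds.congr' ?_)
    filter_upwards [self_mem_nhdsWithin] with ε hε
    simp only [mul_one]
    exact (integral_regWeight_fderiv hR hP hκ hε ξ hφ hφc hf).symm
  have hi₀ : Integrable fun x => (weight P κ x ^ 2) • u₀ x :=
    Continuous.integrable_of_hasCompactSupport (by fun_prop) hu₀s.smul_left
  have hi : ∀ α ∈ P, Integrable fun x => (κ α * ⟪α, ξ⟫) • (weight P κ x ^ 2) • u α x :=
    fun α _ => by
      have := huc α
      exact Integrable.smul _
        (Continuous.integrable_of_hasCompactSupport (by fun_prop) (hus α).smul_left)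
  rw [eq_neg_iff_add_eq_zero, ← hzero, ← integral_add]
  · simp_rw [← integral_smul]
    rw [← integral_finsetSum _ hi, ← integral_add hi₀ (integrable_finsetSum _ hi)]
    refine integral_congr_ae (Eventually.of_forall fun x => ?_)
    simp only [dunklOp, hu₀, hu]
    simp_rw [smul_comm _ (weight P κ x ^ 2)]
    rw [← Finset.smul_sum, ← smul_add, ← smul_add]
    congr 1
    simp_rw [smul_add, add_smul, Finset.sum_add_distrib, Finset.smul_sum, Finset.sum_smul,
      smul_comm (φ x) (_ : ℝ), smul_assoc]
    abel
  · have := (contDiff_dunklOp P κ ξ hf).continuous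
    exact Continuous.integrable_of_hasCompactSupport (by fun_prop)
      (HasCompactSupport.smul_left hφc.smul_right)
  · have := (contDiff_dunklOp P κ ξ hφ).continuous
    exact Continuous.integrable_of_hasCompactSupport (by fun_prop)
      (HasCompactSupport.smul_left (hasCompactSupport_dunklOp hφc P κ ξ).smul_right)

/-- The Dunkl Laplacian is symmetric with respect to the weight `h_κ²`. -/
theorem integral_weight_laplacian [CompleteSpace F] (hR : IsReducedRootSystem R)
    (hP : IsPositiveSystem R P) (hκ : IsMultiplicity R κ)
    {φ : EuclideanSpace ℝ (Fin d) → ℝ} {f : EuclideanSpace ℝ (Fin d) → F}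
    (hφ : ContDiff ℝ ∞ φ) (hφc : HasCompactSupport φ) (hf : ContDiff ℝ ∞ f) :
    ∫ x, (weight P κ x ^ 2) • φ x • laplacian P κ f x =
      ∫ x, (weight P κ x ^ 2) • laplacian P κ φ x • f x := by
  have hκ' : ∀ α ∈ P, 0 ≤ κ α := fun α h => hκ.nonneg α (hP.subset h)
  have hw := continuous_weight_sq hκ'
  have hfc := hf.continuous
  have hφ' := hφ.continuous
  simp only [laplacian, Finset.smul_sum, Finset.sum_smul]
  rw [integral_finsetSum, integral_finsetSum]
  · refine Finset.sum_congr rfl fun j _ => ?_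
    rw [integral_weight_dunklOp hR hP hκ _ hφ hφc (contDiff_dunklOp P κ _ hf),
      integral_weight_dunklOp hR hP hκ _ (contDiff_dunklOp P κ _ hφ)
        (hasCompactSupport_dunklOp hφc P κ _) hf, neg_neg]
  · intro j _
    have := (contDiff_dunklOp P κ (EuclideanSpace.single j 1)
      (contDiff_dunklOp P κ (EuclideanSpace.single j 1) hφ)).continuous
    exact Continuous.integrable_of_hasCompactSupport (by fun_prop)
      (HasCompactSupport.smul_left (hasCompactSupport_dunklOp
        (hasCompactSupport_dunklOp hφc P κ _) P κ _).smul_right)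
  · intro j _
    have := (contDiff_dunklOp P κ (EuclideanSpace.single j 1)
      (contDiff_dunklOp P κ (EuclideanSpace.single j 1) hf)).continuous
    exact Continuous.integrable_of_hasCompactSupport (by fun_prop)
      (HasCompactSupport.smul_left hφc.smul_right)

theorem hasCompactSupport_laplacian_iterate {f : EuclideanSpace ℝ (Fin d) → F}
    (hf : HasCompactSupport f) (n : ℕ) : HasCompactSupport ((laplacian P κ)^[n] f) := by
  induction n with
  | zero => exact hf
  | succ n ih =>
    rw [Function.iterate_succ_apply']
    exact hasCompactSupport_laplacian ih P κ

theorem integral_weight_laplacian_iterate [CompleteSpace F] (hR : IsReducedRootSystem R)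
    (hP : IsPositiveSystem R P) (hκ : IsMultiplicity R κ)
    {φ : EuclideanSpace ℝ (Fin d) → ℝ} {f : EuclideanSpace ℝ (Fin d) → F}
    (hφ : ContDiff ℝ ∞ φ) (hφc : HasCompactSupport φ) (hf : ContDiff ℝ ∞ f) (n : ℕ) :
    ∫ x, (weight P κ x ^ 2) • φ x • (laplacian P κ)^[n] f x =
      ∫ x, (weight P κ x ^ 2) • (laplacian P κ)^[n] φ x • f x := by
  induction n generalizing f with
  | zero => rfl
  | succ n ih =>
    rw [Function.iterate_succ_apply, ih (contDiff_laplacian P κ hf),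
      integral_weight_laplacian hR hP hκ (contDiff_laplacian_iterate P κ hφ n)
        (hasCompactSupport_laplacian_iterate hφc n) hf, Function.iterate_succ_apply']

end IntegrationByParts

/-! ### The Dunkl Laplacian on radial functions -/

section Radial

variable {d : ℕ} {P : Finset (EuclideanSpace ℝ (Fin d))} {κ : EuclideanSpace ℝ (Fin d) → ℝ}

/-- The radial part of the Dunkl Laplacian in the variable `s = ‖x‖²`, with `a = λ_κ + 1`. -/
noncomputable def radialOp (a : ℝ) (g : ℝ → ℝ) (s : ℝ) : ℝ :=
  4 * s * deriv (deriv g) s + 4 * a * deriv g s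

theorem contDiff_radialOp (a : ℝ) {g : ℝ → ℝ} (hg : ContDiff ℝ ∞ g) :
    ContDiff ℝ ∞ (radialOp a g) := by
  have h1 : ContDiff ℝ ∞ (deriv g) := (contDiff_infty_iff_deriv.1 hg).2
  have h2 : ContDiff ℝ ∞ (deriv (deriv g)) := (contDiff_infty_iff_deriv.1 h1).2
  unfold radialOp
  fun_prop

theorem hasFDerivAt_comp_normSq {g : ℝ → ℝ} (hg : ContDiff ℝ ∞ g)
    (x : EuclideanSpace ℝ (Fin d)) :
    HasFDerivAt (fun x : EuclideanSpace ℝ (Fin d) => g (‖x‖ ^ 2))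
      (deriv g (‖x‖ ^ 2) • ((2 : ℝ) • innerSL ℝ x)) x := by
  have h1 : HasFDerivAt (fun x : EuclideanSpace ℝ (Fin d) => ‖x‖ ^ 2) ((2 : ℝ) • innerSL ℝ x) x :=
    (hasStrictFDerivAt_norm_sq x).hasFDerivAt.congr_fderiv (by ext; simp)
  exact (hg.differentiable (by simp) _).hasDerivAt.comp_hasFDerivAt x h1

theorem dunklOp_comp_normSq (ξ : EuclideanSpace ℝ (Fin d)) {g : ℝ → ℝ} (hg : ContDiff ℝ ∞ g) :
    dunklOp P κ ξ (fun x => g (‖x‖ ^ 2)) = fun x => (2 : ℝ) • (⟪x, ξ⟫ * deriv g (‖x‖ ^ 2)) := by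
  ext x
  have h1 : ∀ α, diffQuot α (fun x : EuclideanSpace ℝ (Fin d) => g (‖x‖ ^ 2)) x = 0 := fun α => by
    rw [diffQuot, (hasFDerivAt_comp_normSq hg x).fderiv]
    split_ifs with h
    · rw [real_inner_comm] at h
      simp [h]
    · simp
  simp only [dunklOp, h1, (hasFDerivAt_comp_normSq hg x).fderiv]
  simp
  ring

/-- The radial factor is unchanged by reflections, so the difference part acts on the linear factor
alone and multiplies G by a constant. Summed over an orthonormal basis, each root contributes 2 κ_α;
the dimension d is thereby shifted to d + 2 ∑ κ_α = 2 (λ_κ + 1). -/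
theorem dunklOp_inner_mul_comp_normSq (ξ : EuclideanSpace ℝ (Fin d)) {G : ℝ → ℝ}
    (hG : ContDiff ℝ ∞ G) (x : EuclideanSpace ℝ (Fin d)) :
    dunklOp P κ ξ (fun x => ⟪x, ξ⟫ * G (‖x‖ ^ 2)) x =
      ⟪ξ, ξ⟫ * G (‖x‖ ^ 2) + 2 * ⟪x, ξ⟫ ^ 2 * deriv G (‖x‖ ^ 2) +
        ∑ α ∈ P, 2 * κ α * (⟪α, ξ⟫ ^ 2 / ⟪α, α⟫) * G (‖x‖ ^ 2) := by
  have h0 : HasFDerivAt (fun x : EuclideanSpace ℝ (Fin d) => ⟪x, ξ⟫) (innerSL ℝ ξ) x :=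
    (innerSL ℝ ξ).hasFDerivAt.congr_of_eventuallyEq
      (Eventually.of_forall fun y => real_inner_comm _ _)
  have h1 := h0.mul (hasFDerivAt_comp_normSq hG x)
  have h2 : ∀ v, fderiv ℝ (fun x : EuclideanSpace ℝ (Fin d) => ⟪x, ξ⟫ * G (‖x‖ ^ 2)) x v =
      ⟪ξ, v⟫ * G (‖x‖ ^ 2) + 2 * ⟪x, ξ⟫ * ⟪x, v⟫ * deriv G (‖x‖ ^ 2) := fun v => by
    rw [(show HasFDerivAt (fun x => ⟪x, ξ⟫ * G (‖x‖ ^ 2)) _ x from h1).fderiv]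
    simp
    ring
  have h3 : ∀ α, diffQuot α (fun x : EuclideanSpace ℝ (Fin d) => ⟪x, ξ⟫ * G (‖x‖ ^ 2)) x =
      2 * ⟪α, ξ⟫ / ⟪α, α⟫ * G (‖x‖ ^ 2) := fun α => by
    rw [diffQuot, h2]
    split_ifs with h
    · rw [real_inner_comm] at h
      rw [h, real_inner_comm α ξ, smul_eq_mul]
      ring
    · rw [LinearIsometryEquiv.norm_map, refl_apply, inner_sub_left, inner_smul_left, smul_eq_mul]
      simp only [conj_trivial]
      field_simp
      ring
  rw [dunklOp, h2]
  congr 1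
  · ring
  · refine Finset.sum_congr rfl fun α _ => ?_
    rw [h3, smul_eq_mul]
    ring

theorem sum_inner_single_sq (x : EuclideanSpace ℝ (Fin d)) :
    ∑ j : Fin d, ⟪x, EuclideanSpace.single j (1 : ℝ)⟫ ^ 2 = ‖x‖ ^ 2 := by
  rw [EuclideanSpace.real_norm_sq_eq]
  simp [EuclideanSpace.inner_single_right]

/-- The Dunkl Laplacian of a radial function. -/
theorem laplacian_comp_normSq (hP : ∀ α ∈ P, α ≠ 0) {g : ℝ → ℝ} (hg : ContDiff ℝ ∞ g) :
    laplacian P κ (fun x => g (‖x‖ ^ 2)) = fun x => radialOp (lam P κ + 1) g (‖x‖ ^ 2) := by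
  have hg' : ContDiff ℝ ∞ (deriv g) := (contDiff_infty_iff_deriv.1 hg).2
  ext x
  have h1 : ∀ α ∈ P, ∑ j : Fin d, 2 * κ α * (⟪α, EuclideanSpace.single j (1 : ℝ)⟫ ^ 2 / ⟪α, α⟫) *
      deriv g (‖x‖ ^ 2) = 2 * κ α * deriv g (‖x‖ ^ 2) := fun α hα => by
    rw [← Finset.sum_mul, ← Finset.mul_sum, ← Finset.sum_div, sum_inner_single_sq,
      real_inner_self_eq_norm_sq, div_self (by simpa using hP α hα), mul_one]
  simp only [laplacian]
  simp_rw [dunklOp_comp_normSq _ hg, dunklOp_const_smul, dunklOp_inner_mul_comp_normSq _ hg']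
  rw [← Finset.smul_sum, Finset.sum_add_distrib, Finset.sum_add_distrib, Finset.sum_comm,
    Finset.sum_congr rfl h1, ← Finset.sum_mul, ← Finset.sum_mul, ← Finset.sum_mul,
    ← Finset.mul_sum, ← Finset.mul_sum, sum_inner_single_sq, radialOp, lam]
  simp
  ring

theorem laplacian_iterate_comp_normSq (hP : ∀ α ∈ P, α ≠ 0) {g : ℝ → ℝ} (hg : ContDiff ℝ ∞ g)
    (n : ℕ) : (laplacian P κ)^[n] (fun x => g (‖x‖ ^ 2)) =
      fun x => (radialOp (lam P κ + 1))^[n] g (‖x‖ ^ 2) := by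
  induction n generalizing g with
  | zero => rfl
  | succ n ih =>
    rw [Function.iterate_succ_apply, laplacian_comp_normSq hP hg, ih (contDiff_radialOp _ hg),
      Function.iterate_succ_apply]

theorem laplacian_iterate_const_smul {F : Type*} [NormedAddCommGroup F] [NormedSpace ℝ F]
    (f : EuclideanSpace ℝ (Fin d) → F) (c : ℝ) (n : ℕ) :
    (laplacian P κ)^[n] (fun x => c • f x) = fun x => c • (laplacian P κ)^[n] f x := by
  induction n generalizing f with
  | zero => rfl
  | succ n ih =>
    rw [Function.iterate_succ_apply, laplacian_const_smul, ih, Function.iterate_succ_apply]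

theorem laplacian_iterate_normSq_pow (hP : ∀ α ∈ P, α ≠ 0) (n : ℕ) :
    (laplacian P κ)^[n] (fun x => (‖x‖ ^ 2) ^ n) =
      fun _ => 4 ^ n * (n.factorial * (ascPochhammer ℝ n).eval (lam P κ + 1)) := by
  induction n with
  | zero => simp
  | succ n ih =>
    have h1 : laplacian P κ (fun x => (‖x‖ ^ 2) ^ (n + 1)) =
        fun x => (4 * (n + 1) * (lam P κ + 1 + n)) • (‖x‖ ^ 2) ^ n := by
      rw [laplacian_comp_normSq (g := fun s => s ^ (n + 1)) hP (by fun_prop)]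
      ext x
      have e1 : deriv (fun s : ℝ => s ^ (n + 1)) = fun s : ℝ => ((n : ℝ) + 1) * s ^ n := by
        ext s; simp
      have e2 : deriv (fun s : ℝ => ((n : ℝ) + 1) * s ^ n) =
          fun s : ℝ => ((n : ℝ) + 1) * (n * s ^ (n - 1)) := by
        ext s; simp
      rw [radialOp, e1, e2, smul_eq_mul]
      -- The exponent n - 1 is truncated at n = 0, where the coefficient n vanishes anyway.
      rcases n with _ | n
      · simp
      · simp only [Nat.add_sub_cancel]
        push_cast
        ring
    rw [Function.iterate_succ_apply, h1, laplacian_iterate_const_smul, ih]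
    ext x
    rw [ascPochhammer_succ_eval, Nat.factorial_succ, smul_eq_mul]
    push_cast
    ring

end Radial

/-! ### Polar coordinates -/

section Polar

variable {d : ℕ} {F : Type*} [NormedAddCommGroup F] [NormedSpace ℝ F]

/-- Polar coordinates for the product of a radial and a homogeneous function. -/
theorem integral_radial_smul_homogeneous (hd : 0 < d) {A : EuclideanSpace ℝ (Fin d) → F} {s : ℝ}
    (hA : ∀ r : ℝ, 0 < r → ∀ y, A (r • y) = r ^ s • A y) (B : ℝ → ℝ) :
    ∫ x, B ‖x‖ • A x =
      (∫ r : Set.Ioi (0 : ℝ), r.1 ^ s * B r ∂(Measure.volumeIoiPow (d - 1))) •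
        ∫ y : Metric.sphere (0 : EuclideanSpace ℝ (Fin d)) 1, A y ∂(surface d) := by
  have : Nonempty (Fin d) := ⟨⟨0, hd⟩⟩
  have hfin : Module.finrank ℝ (EuclideanSpace ℝ (Fin d)) = d := by simp
  have h1 : ∀ x : ({0}ᶜ : Set (EuclideanSpace ℝ (Fin d))), B ‖x.1‖ • A x.1 =
      (fun z : Metric.sphere (0 : EuclideanSpace ℝ (Fin d)) 1 × Set.Ioi (0 : ℝ) =>
        (z.2.1 ^ s * B z.2) • A z.1) (homeomorphUnitSphereProd _ x) := fun x => by
    have hx : 0 < ‖x.1‖ := norm_pos_iff.2 x.2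
    simp only [homeomorphUnitSphereProd_apply_snd_coe, homeomorphUnitSphereProd_apply_fst_coe]
    rw [mul_comm, mul_smul, ← hA _ hx, smul_inv_smul₀ hx.ne']
  calc ∫ x, B ‖x‖ • A x
      = ∫ x : ({0}ᶜ : Set (EuclideanSpace ℝ (Fin d))), B ‖x.1‖ • A x.1 ∂(volume.comap Subtype.val) := by
        rw [integral_subtype_comap (measurableSet_singleton _).compl fun x => B ‖x‖ • A x,
          restrict_compl_singleton]
    _ = ∫ z : Metric.sphere (0 : EuclideanSpace ℝ (Fin d)) 1 × Set.Ioi (0 : ℝ),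
          (z.2.1 ^ s * B z.2) • A z.1 ∂((surface d).prod (Measure.volumeIoiPow (d - 1))) := by
        simp_rw [h1]
        have h2 := (volume : Measure
          (EuclideanSpace ℝ (Fin d))).measurePreserving_homeomorphUnitSphereProd.integral_comp
          (Homeomorph.measurableEmbedding _)
          (fun z : Metric.sphere (0 : EuclideanSpace ℝ (Fin d)) 1 × Set.Ioi (0 : ℝ) =>
            (z.2.1 ^ s * B z.2) • A z.1)
        rw [hfin] at h2
        exact h2
    _ = _ := by
        have : SFinite (surface d) := by unfold surface; infer_instance
        rw [← integral_prod_swap]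
        -- The integral of a product splits without any integrability assumption.
        exact integral_prod_smul (fun r : Set.Ioi (0 : ℝ) => r.1 ^ s * B r)
          (fun y : Metric.sphere (0 : EuclideanSpace ℝ (Fin d)) 1 => A y)

end Polar

/-! ### Iterated Laplacians at the origin as spherical integrals -/

section Moments

variable {d : ℕ} {F : Type*} [NormedAddCommGroup F] [NormedSpace ℝ F]
  {R P : Finset (EuclideanSpace ℝ (Fin d))} {κ : EuclideanSpace ℝ (Fin d) → ℝ}

/-- The profile of a smooth radial bump function supported in the unit ball. -/
noncomputable def bumpProfile (s : ℝ) : ℝ := Real.smoothTransition (1 - s)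

theorem contDiff_bumpProfile : ContDiff ℝ ∞ bumpProfile :=
  Real.smoothTransition.contDiff.comp (contDiff_const.sub contDiff_id)

theorem contDiff_bump : ContDiff ℝ ∞ fun x : EuclideanSpace ℝ (Fin d) => bumpProfile (‖x‖ ^ 2) :=
  contDiff_bumpProfile.comp (contDiff_norm_sq ℝ)

theorem bump_eq_zero {x : EuclideanSpace ℝ (Fin d)} (hx : 1 < ‖x‖) : bumpProfile (‖x‖ ^ 2) = 0 :=
  Real.smoothTransition.zero_of_nonpos (by nlinarith)

theorem hasCompactSupport_bump :
    HasCompactSupport fun x : EuclideanSpace ℝ (Fin d) => bumpProfile (‖x‖ ^ 2) :=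
  hasCompactSupport_of_radius fun _ => bump_eq_zero

theorem laplacian_iterate_eq_zero_of_radius {f : EuclideanSpace ℝ (Fin d) → F} {ρ : ℝ}
    (h : ∀ x, ρ < ‖x‖ → f x = 0) (n : ℕ) {x : EuclideanSpace ℝ (Fin d)} (hx : ρ < ‖x‖) :
    (laplacian P κ)^[n] f x = 0 := by
  induction n generalizing f with
  | zero => exact h x hx
  | succ n ih =>
    rw [Function.iterate_succ_apply]
    exact ih fun y hy => laplacian_eq_zero_of_radius h P κ hy

variable (P κ) in
/-- `∫ h_κ² φ`, where `φ` is the standard bump. -/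
noncomputable def bumpMass : ℝ :=
  ∫ x : EuclideanSpace ℝ (Fin d), weight P κ x ^ 2 * bumpProfile (‖x‖ ^ 2)

theorem continuous_weight_bump (hκ : ∀ α ∈ P, 0 ≤ κ α) :
    Continuous fun x : EuclideanSpace ℝ (Fin d) => weight P κ x ^ 2 * bumpProfile (‖x‖ ^ 2) := by
  have h1 := continuous_weight_sq hκ
  have h2 := (contDiff_bump (d := d)).continuous
  fun_prop

theorem exists_inner_ne_zero (hP : ∀ α ∈ P, α ≠ 0) {ρ : ℝ} (hρ : 0 < ρ) :
    ∃ x ∈ Metric.ball (0 : EuclideanSpace ℝ (Fin d)) ρ, ∀ α ∈ P, ⟪α, x⟫ ≠ 0 := by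
  have h : ∀ᵐ x : EuclideanSpace ℝ (Fin d), ∀ α ∈ P, ⟪α, x⟫ ≠ 0 :=
    (Finset.eventually_all P).2 fun α hα => ae_inner_ne_zero (hP α hα)
  have h2 : ∃ᶠ x : EuclideanSpace ℝ (Fin d) in ae volume, x ∈ Metric.ball 0 ρ :=
    frequently_ae_mem_iff.2 (Metric.measure_ball_pos volume 0 hρ).ne'
  obtain ⟨x, hx, hx'⟩ := (h2.and_eventually h).exists
  exact ⟨x, hx, hx'⟩

theorem integral_weight_bump_mul_norm_pow_pos (hd : 0 < d) (hP : ∀ α ∈ P, α ≠ 0)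
    (hκ : ∀ α ∈ P, 0 ≤ κ α) (k : ℕ) :
    0 < ∫ x : EuclideanSpace ℝ (Fin d), weight P κ x ^ 2 * bumpProfile (‖x‖ ^ 2) * ‖x‖ ^ k := by
  have : Nonempty (Fin d) := ⟨⟨0, hd⟩⟩
  obtain ⟨v, hv⟩ := exists_ne (0 : EuclideanSpace ℝ (Fin d))
  -- The auxiliary vector v forces the point to be nonzero, so that ‖x‖^k does not vanish there,
  -- even if P is empty.
  obtain ⟨x, hx, hx'⟩ := exists_inner_ne_zero (P := insert v P)
    (by intro α hα; rcases Finset.mem_insert.1 hα with rfl | h; exacts [hv, hP α h]) one_pos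
  have hc := continuous_weight_bump hκ
  have hb : ∀ s, 0 ≤ bumpProfile s := fun s => Real.smoothTransition.nonneg _
  refine Continuous.integral_pos_of_hasCompactSupport_nonneg_nonzero (x := x) (by fun_prop) ?_ ?_ ?_
  · exact (HasCompactSupport.mul_left hasCompactSupport_bump).mul_right
  · intro x
    have := hb (‖x‖ ^ 2)
    positivity
  · have hx0 : x ≠ 0 := by
      rintro rfl
      exact hx' v (Finset.mem_insert_self _ _) (inner_zero_right _)
    refine mul_ne_zero (mul_ne_zero (pow_ne_zero 2 (Finset.prod_ne_zero_iff.2 fun α hα => ?_)) ?_)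
      (pow_ne_zero _ (norm_ne_zero_iff.2 hx0))
    · exact (Real.rpow_pos_of_pos (abs_pos.2 (hx' α (Finset.mem_insert_of_mem hα))) _).ne'
    · rw [mem_ball_zero_iff] at hx
      have h1 : 0 < 1 - ‖x‖ ^ 2 := by nlinarith [norm_nonneg x]
      exact (Real.smoothTransition.pos_of_pos h1).ne'

theorem bumpMass_pos (hd : 0 < d) (hP : ∀ α ∈ P, α ≠ 0) (hκ : ∀ α ∈ P, 0 ≤ κ α) :
    0 < bumpMass P κ := by
  simpa [bumpMass] using integral_weight_bump_mul_norm_pow_pos hd hP hκ 0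

theorem continuous_integral_smul_comp_smul {u : EuclideanSpace ℝ (Fin d) → ℝ}
    {g : EuclideanSpace ℝ (Fin d) → F} (hu : Continuous u) (huc : HasCompactSupport u)
    (hg : Continuous g) : Continuous fun t : ℝ => ∫ x, u x • g (t • x) := by
  obtain ⟨ρ, h⟩ := exists_radius_of_hasCompactSupport huc
  have h1 := continuous_parametric_integral_of_continuous (μ := volume)
    (f := fun (t : ℝ) x => u x • g (t • x)) (by fun_prop)
    (isCompact_closedBall (0 : EuclideanSpace ℝ (Fin d)) ρ)
  refine h1.congr fun t => setIntegral_eq_integral_of_forall_compl_eq_zero fun x hx => ?_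
  rw [h x (by simpa using hx), zero_smul]

/-- Symmetry of Δ_κ^n applied to the dilate f(t·), with the power t^{2n} supplied by homogeneity.
For t → 0 the left integral isolates the value of Δ_κ^n f at 0, while the right one sees only the
Taylor expansion of f. -/
theorem pow_smul_integral_laplacian_iterate [CompleteSpace F] (hR : IsReducedRootSystem R)
    (hP : IsPositiveSystem R P) (hκ : IsMultiplicity R κ) {f : EuclideanSpace ℝ (Fin d) → F}
    (hf : ContDiff ℝ ∞ f) (n : ℕ) {t : ℝ} (ht : t ≠ 0) :
    t ^ (2 * n) • ∫ x, (weight P κ x ^ 2 * bumpProfile (‖x‖ ^ 2)) • (laplacian P κ)^[n] f (t • x) =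
      ∫ x, (weight P κ x ^ 2 * (laplacian P κ)^[n] (fun x => bumpProfile (‖x‖ ^ 2)) x) •
        f (t • x) := by
  have h := integral_weight_laplacian_iterate hR hP hκ contDiff_bump hasCompactSupport_bump
    (f := fun x => f (t • x)) (hf.comp (contDiff_const_smul t)) n
  simp_rw [laplacian_iterate_comp_smul P κ f ht] at h
  rw [← integral_smul]
  simp_rw [mul_smul]
  rw [← h]
  refine integral_congr_ae (Eventually.of_forall fun x => ?_)
  simp only [smul_smul]
  congr 1
  ring

theorem tendsto_integral_bump_smul (hκ : ∀ α ∈ P, 0 ≤ κ α) {g : EuclideanSpace ℝ (Fin d) → F}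
    (hg : Continuous g) [CompleteSpace F] :
    Tendsto (fun t : ℝ => ∫ x, (weight P κ x ^ 2 * bumpProfile (‖x‖ ^ 2)) • g (t • x)) (𝓝[≠] 0)
      (𝓝 (bumpMass P κ • g 0)) := by
  have h := (continuous_integral_smul_comp_smul (continuous_weight_bump hκ)
    (hasCompactSupport_bump.mul_left) hg).tendsto 0
  simp_rw [zero_smul] at h
  rw [integral_smul_const] at h
  exact h.mono_left nhdsWithin_le_nhds

theorem continuous_weight_laplacian_bump (hκ : ∀ α ∈ P, 0 ≤ κ α) (n : ℕ) :
    Continuous fun x : EuclideanSpace ℝ (Fin d) =>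
      weight P κ x ^ 2 * (laplacian P κ)^[n] (fun x => bumpProfile (‖x‖ ^ 2)) x :=
  (continuous_weight_sq hκ).mul (contDiff_laplacian_iterate P κ contDiff_bump n).continuous

/-- Only the homogeneous component of degree `2 n` of a function contributes to its pairing with
the `n`-th Laplacian of the bump. -/
theorem integral_laplacian_bump_smul_eq_zero [CompleteSpace F] (hR : IsReducedRootSystem R)
    (hP : IsPositiveSystem R P) (hκ : IsMultiplicity R κ) {p : EuclideanSpace ℝ (Fin d) → F}
    (hp : ContDiff ℝ ∞ p) {k n : ℕ} (hk : k < 2 * n)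
    (hhom : ∀ (t : ℝ) x, p (t • x) = t ^ k • p x) :
    ∫ x, (weight P κ x ^ 2 * (laplacian P κ)^[n] (fun x => bumpProfile (‖x‖ ^ 2)) x) • p x = 0 := by
  have hκ' : ∀ α ∈ P, 0 ≤ κ α := fun α h => hκ.nonneg α (hP.subset h)
  have h1 := tendsto_integral_bump_smul hκ' (contDiff_laplacian_iterate P κ hp n).continuous
  -- By homogeneity of p, the integral in question equals t^{2n-k} times a convergent quantity for
  -- every t ≠ 0; since k < 2n, it must be zero.
  have h2 : Tendsto (fun t : ℝ => t ^ (2 * n - k)) (𝓝[≠] 0) (𝓝 0) := by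
    have := (continuous_pow (M := ℝ) (2 * n - k)).tendsto 0
    rw [zero_pow (by omega)] at this
    exact this.mono_left nhdsWithin_le_nhds
  have h3 := h2.smul h1
  rw [zero_smul] at h3
  refine tendsto_nhds_unique (tendsto_const_nhds.congr' ?_) h3
  filter_upwards [self_mem_nhdsWithin] with t ht
  have h4 := pow_smul_integral_laplacian_iterate hR hP hκ hp n ht
  simp_rw [hhom, smul_comm _ (t ^ k)] at h4
  rw [integral_smul] at h4
  have h5 : t ^ k ≠ 0 := pow_ne_zero _ ht
  rw [← smul_right_inj h5, ← h4, smul_smul, ← pow_add]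
  congr 2
  omega

/-- A function with the expansion `f(tx) = ∑_{k ≤ 2n} t^k p_k(x) + O(t^{2n+1})` has
`(Δ_κ^n f)(0)` determined by `p_{2n}`. -/
theorem bumpMass_smul_laplacian_iterate [CompleteSpace F] (hR : IsReducedRootSystem R)
    (hP : IsPositiveSystem R P) (hκ : IsMultiplicity R κ) {f : EuclideanSpace ℝ (Fin d) → F}
    (hf : ContDiff ℝ ∞ f) {p : ℕ → EuclideanSpace ℝ (Fin d) → F} (hp : ∀ k, ContDiff ℝ ∞ (p k))
    (hhom : ∀ k (t : ℝ) x, p k (t • x) = t ^ k • p k x) (n : ℕ) {C : ℝ}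
    (hC : ∀ x, ‖x‖ ≤ 1 → ‖f x - ∑ k ∈ Finset.range (2 * n + 1), p k x‖ ≤ C * ‖x‖ ^ (2 * n + 1)) :
    bumpMass P κ • (laplacian P κ)^[n] f 0 =
      ∫ x, (weight P κ x ^ 2 * (laplacian P κ)^[n] (fun x => bumpProfile (‖x‖ ^ 2)) x) •
        p (2 * n) x := by
  have hκ' : ∀ α ∈ P, 0 ≤ κ α := fun α h => hκ.nonneg α (hP.subset h)
  set u : EuclideanSpace ℝ (Fin d) → ℝ := fun x =>
    weight P κ x ^ 2 * (laplacian P κ)^[n] (fun x => bumpProfile (‖x‖ ^ 2)) x with hu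
  have huc : Continuous u := continuous_weight_laplacian_bump hκ' n
  have hu0 : ∀ x, 1 < ‖x‖ → u x = 0 := fun x hx => by
    simp only [hu]
    rw [laplacian_iterate_eq_zero_of_radius (fun _ => bump_eq_zero) n hx, mul_zero]
  have hus : HasCompactSupport u := hasCompactSupport_of_radius hu0
  have hfc := hf.continuous
  have hpc := fun k => (hp k).continuous
  have hi : ∀ k, Integrable fun x => u x • p k x := fun k =>
    Continuous.integrable_of_hasCompactSupport (huc.smul (hpc k)) hus.smul_right
  have h1 := tendsto_integral_bump_smul hκ' (contDiff_laplacian_iterate P κ hf n).continuous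
  refine tendsto_nhds_unique h1 ?_
  have hlow : ∀ k, k < 2 * n → ∫ x, u x • p k x = 0 := fun k hk =>
    integral_laplacian_bump_smul_eq_zero hR hP hκ (hp k) hk (hhom k)
  have hsum : ∀ t : ℝ, ∫ x, u x • ∑ k ∈ Finset.range (2 * n + 1), p k (t • x) =
      t ^ (2 * n) • ∫ x, u x • p (2 * n) x := fun t => by
    simp_rw [Finset.smul_sum, hhom, smul_comm (u _)]
    have hi' : ∀ k ∈ Finset.range (2 * n + 1), Integrable fun x => t ^ k • u x • p k x :=
      fun k _ => (hi k).smul (t ^ k)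
    rw [integral_finsetSum _ hi', Finset.sum_range_succ,
      Finset.sum_eq_zero, zero_add, integral_smul]
    intro k hk
    rw [integral_smul, hlow k (Finset.mem_range.1 hk), smul_zero]
  rw [tendsto_iff_norm_sub_tendsto_zero]
  -- The Taylor remainder at t x is of order |t|^{2n+1}; after division by |t|^{2n} one factor |t|
  -- is left.
  have hK : Tendsto (fun t : ℝ => |t| * ∫ x, ‖u x‖ * (C * ‖x‖ ^ (2 * n + 1))) (𝓝[≠] 0) (𝓝 0) := by
    have : Continuous fun t : ℝ => |t| * ∫ x, ‖u x‖ * (C * ‖x‖ ^ (2 * n + 1)) := by fun_prop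
    have h2 := this.tendsto 0
    rw [abs_zero, zero_mul] at h2
    exact h2.mono_left nhdsWithin_le_nhds
  refine squeeze_zero' (Eventually.of_forall fun t => norm_nonneg _) ?_ hK
  have hnhds : Metric.ball (0 : ℝ) 1 ∈ 𝓝[≠] (0 : ℝ) :=
    mem_nhdsWithin_of_mem_nhds (Metric.ball_mem_nhds 0 one_pos)
  filter_upwards [self_mem_nhdsWithin, hnhds] with t ht ht1
  rw [mem_ball_zero_iff, Real.norm_eq_abs] at ht1
  have ht0 : t ≠ 0 := ht
  have htp : 0 < |t| ^ (2 * n) := by positivity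
  -- Multiplying the estimate by |t|^{2n} allows Δ_κ^n to be moved onto the bump, so that both terms
  -- become integrals against u.
  rw [← mul_le_mul_iff_right₀ htp, ← abs_pow, ← Real.norm_eq_abs, ← norm_smul, smul_sub,
    pow_smul_integral_laplacian_iterate hR hP hκ hf n ht, ← hsum, ← integral_sub]
  · have h2 : ∀ x, u x • f (t • x) - u x • ∑ k ∈ Finset.range (2 * n + 1), p k (t • x) =
        u x • (f (t • x) - ∑ k ∈ Finset.range (2 * n + 1), p k (t • x)) := fun x =>
      (smul_sub _ _ _).symm
    rw [Real.norm_eq_abs, abs_pow, ← mul_assoc, ← pow_succ, ← integral_const_mul]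
    refine norm_integral_le_of_norm_le ?_ (Eventually.of_forall fun x => ?_)
    · refine Continuous.integrable_of_hasCompactSupport (by fun_prop) ?_
      exact (hus.norm.mul_right).mul_left
    · rw [h2, norm_smul]
      rcases lt_or_ge 1 ‖x‖ with hx | hx
      · simp [hu0 x hx]
      · have h3 := hC (t • x) (by
          rw [norm_smul, Real.norm_eq_abs]
          exact mul_le_one₀ ht1.le (norm_nonneg _) hx)
        rw [norm_smul, Real.norm_eq_abs, mul_pow] at h3
        calc ‖u x‖ * _ ≤ ‖u x‖ * (C * (|t| ^ (2 * n + 1) * ‖x‖ ^ (2 * n + 1))) := by gcongr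
          _ = _ := by ring
  · exact Continuous.integrable_of_hasCompactSupport
      (huc.smul (hfc.comp (continuous_const_smul t))) hus.smul_right
  · exact Continuous.integrable_of_hasCompactSupport (by fun_prop) hus.smul_right

variable (P κ) in
/-- The unnormalised weighted spherical integral. -/
noncomputable def sphereIntegral (p : EuclideanSpace ℝ (Fin d) → F) : F :=
  ∫ y : Metric.sphere (0 : EuclideanSpace ℝ (Fin d)) 1,
    weight P κ (y : EuclideanSpace ℝ (Fin d)) ^ 2 • p y ∂(surface d)

/-- The radial factor depends on p only through its degree k. Two homogeneous functions of the same
degree can therefore be compared without evaluating it. -/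
theorem integral_radial_smul_eq_sphereIntegral (hd : 0 < d) {p : EuclideanSpace ℝ (Fin d) → F}
    {k : ℕ} (hhom : ∀ (t : ℝ) x, p (t • x) = t ^ k • p x) (B : ℝ → ℝ) :
    ∫ x, (weight P κ x ^ 2 * B (‖x‖ ^ 2)) • p x =
      (∫ r : Set.Ioi (0 : ℝ), r.1 ^ (2 * ∑ α ∈ P, κ α + k) * B (r.1 ^ 2)
        ∂(Measure.volumeIoiPow (d - 1))) • sphereIntegral P κ p := by
  rw [sphereIntegral, ← integral_radial_smul_homogeneous hd (A := fun x => weight P κ x ^ 2 • p x)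
    (B := fun r => B (r ^ 2))]
  · refine integral_congr_ae (Eventually.of_forall fun x => ?_)
    simp only [smul_smul]
    rw [mul_comm]
  · intro r hr y
    rw [weight_sq_smul hr, hhom, Real.rpow_add_natCast hr.ne', smul_smul, smul_smul]
    congr 1
    ring

/-- Odd homogeneous functions have vanishing spherical means. -/
theorem sphereIntegral_eq_zero_of_odd (hd : 0 < d) (hP : ∀ α ∈ P, α ≠ 0)
    (hκ : ∀ α ∈ P, 0 ≤ κ α) {p : EuclideanSpace ℝ (Fin d) → F} {k : ℕ} (hk : Odd k)
    (hhom : ∀ (t : ℝ) x, p (t • x) = t ^ k • p x) : sphereIntegral P κ p = 0 := by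
  have h1 := integral_radial_smul_eq_sphereIntegral (P := P) (κ := κ) hd hhom bumpProfile
  have hneg : ∀ x, p (-x) = -p x := fun x => by
    have := hhom (-1) x
    rwa [neg_one_smul, hk.neg_one_pow, neg_one_smul] at this
  have h2 : ∫ x, (weight P κ x ^ 2 * bumpProfile (‖x‖ ^ 2)) • p x = 0 := by
    have h3 := integral_neg_eq_self
      (fun x => (weight P κ x ^ 2 * bumpProfile (‖x‖ ^ 2)) • p x) volume
    simp only [hneg, weight_sq_neg, norm_neg, smul_neg] at h3
    rw [integral_neg] at h3
    have h4 : (2 : ℝ) • ∫ x, (weight P κ x ^ 2 * bumpProfile (‖x‖ ^ 2)) • p x = 0 := by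
      rw [two_smul]
      nth_rw 1 [← h3]
      exact neg_add_cancel _
    exact (smul_eq_zero.1 h4).resolve_left two_ne_zero
  rw [h2] at h1
  -- The radial factor is nonzero: otherwise polar coordinates would give ∫ h_κ² φ ‖x‖^k = 0,
  -- contradicting positivity of the integrand's mass.
  refine (smul_eq_zero.1 h1.symm).resolve_left fun h5 => ?_
  have h6 := integral_radial_smul_homogeneous hd
    (A := fun x : EuclideanSpace ℝ (Fin d) => weight P κ x ^ 2) (fun r hr y => weight_sq_smul hr y)
    (fun r => r ^ k * bumpProfile (r ^ 2))
  have h7 : ∫ r : Set.Ioi (0 : ℝ), r.1 ^ (2 * ∑ α ∈ P, κ α) * (r.1 ^ k * bumpProfile (r.1 ^ 2))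
      ∂(Measure.volumeIoiPow (d - 1)) = 0 := by
    refine Eq.trans (integral_congr_ae (Eventually.of_forall fun r => ?_)) h5
    simp only
    rw [Real.rpow_add_natCast (ne_of_gt r.2), mul_assoc]
  rw [h7, zero_smul] at h6
  refine (integral_weight_bump_mul_norm_pow_pos hd hP hκ k).ne'
    (Eq.trans (integral_congr_ae (Eventually.of_forall fun x => ?_)) h6)
  simp only [smul_eq_mul]
  ring

/-- The value `(Δ_κ^n f)(0)` as a spherical integral of the homogeneous component of degree `2n`. -/
theorem omega_smul_laplacian_iterate [CompleteSpace F] (hd : 0 < d) (hR : IsReducedRootSystem R)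
    (hP : IsPositiveSystem R P) (hκ : IsMultiplicity R κ) {f : EuclideanSpace ℝ (Fin d) → F}
    (hf : ContDiff ℝ ∞ f) {p : ℕ → EuclideanSpace ℝ (Fin d) → F} (hp : ∀ k, ContDiff ℝ ∞ (p k))
    (hhom : ∀ k (t : ℝ) x, p k (t • x) = t ^ k • p k x) (n : ℕ) {C : ℝ}
    (hC : ∀ x, ‖x‖ ≤ 1 → ‖f x - ∑ k ∈ Finset.range (2 * n + 1), p k x‖ ≤ C * ‖x‖ ^ (2 * n + 1)) :
    omega P κ • (laplacian P κ)^[n] f 0 =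
      (4 ^ n * (n.factorial * (ascPochhammer ℝ n).eval (lam P κ + 1))) •
        sphereIntegral P κ (p (2 * n)) := by
  have hκ' : ∀ α ∈ P, 0 ≤ κ α := fun α h => hκ.nonneg α (hP.subset h)
  have hP0 : ∀ α ∈ P, α ≠ 0 := fun α hα h => hR.zero_notMem (h ▸ hP.subset hα)
  have hrad := laplacian_iterate_comp_normSq (κ := κ) hP0 contDiff_bumpProfile n
  have h1 := bumpMass_smul_laplacian_iterate hR hP hκ hf hp hhom n hC
  -- The test function ‖x‖^{2n} is its own homogeneous component of degree 2n, so its expansion is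
  -- exact and the error constant is 0.
  set q : ℕ → EuclideanSpace ℝ (Fin d) → ℝ := fun k x => if k = 2 * n then (‖x‖ ^ 2) ^ n else 0
    with hq
  have hq' : q (2 * n) = fun x => (‖x‖ ^ 2) ^ n := by ext x; simp [hq]
  have hqhom : ∀ k (t : ℝ) x, q k (t • x) = t ^ k • q k x := fun k t x => by
    simp only [hq]
    split_ifs with h
    · rw [norm_smul, mul_pow, mul_pow, smul_eq_mul, h, Real.norm_eq_abs, sq_abs, pow_mul]
    · simp
  have hns : ContDiff ℝ ∞ fun x : EuclideanSpace ℝ (Fin d) => (‖x‖ ^ 2) ^ n :=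
    (contDiff_norm_sq ℝ).pow n
  have h2 := bumpMass_smul_laplacian_iterate (C := 0) hR hP hκ
    hns (p := q) (fun k => by
      simp only [hq]
      split_ifs
      exacts [hns, contDiff_const]) hqhom n (fun x _ => by
        rw [Finset.sum_eq_single (2 * n)] <;> simp +contextual [hq])
  rw [laplacian_iterate_normSq_pow hP0, hrad,
    integral_radial_smul_eq_sphereIntegral hd (hqhom _)] at h2
  rw [hrad, integral_radial_smul_eq_sphereIntegral hd (hhom _)] at h1
  have h3 : sphereIntegral P κ (q (2 * n)) = omega P κ := by
    rw [sphereIntegral, omega, hq']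
    simp
  rw [h3, smul_eq_mul, smul_eq_mul] at h2
  -- The identities `h1` for f and `h2` for ‖x‖^{2n} contain the same radial factor, which cancels
  -- after multiplication by the nonzero mass of the bump.
  rw [← smul_right_inj (bumpMass_pos hd hP0 hκ').ne', smul_comm, h1, smul_smul, smul_smul, h2,
    mul_comm]

end Moments

/-! ### Pizzetti's expansion for globally smooth functions -/

section Pizzetti

variable {d : ℕ} {F : Type*} [NormedAddCommGroup F] [NormedSpace ℝ F]
  {R P : Finset (EuclideanSpace ℝ (Fin d))} {κ : EuclideanSpace ℝ (Fin d) → ℝ}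

/-- The homogeneous component of degree `k` of the Taylor expansion of `f` at the origin. -/
noncomputable def taylorTerm (f : EuclideanSpace ℝ (Fin d) → F) (k : ℕ)
    (x : EuclideanSpace ℝ (Fin d)) : F :=
  (k.factorial : ℝ)⁻¹ • iteratedFDeriv ℝ k f 0 fun _ => x

theorem contDiff_taylorTerm (f : EuclideanSpace ℝ (Fin d) → F) (k : ℕ) :
    ContDiff ℝ ∞ (taylorTerm f k) :=
  ((iteratedFDeriv ℝ k f 0).contDiff.comp (contDiff_pi.2 fun _ => contDiff_id)).const_smul _

theorem taylorTerm_smul (f : EuclideanSpace ℝ (Fin d) → F) (k : ℕ) (t : ℝ)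
    (x : EuclideanSpace ℝ (Fin d)) : taylorTerm f k (t • x) = t ^ k • taylorTerm f k x := by
  have h := (iteratedFDeriv ℝ k f 0).map_smul_univ (fun _ => t) fun _ => x
  rw [Finset.prod_const, Finset.card_univ, Fintype.card_fin] at h
  rw [taylorTerm, h, smul_comm, taylorTerm]

/-- The integral form of the remainder, with C a bound for the derivative of order m + 1 on the
closed unit ball; 1/m! and (1 - t)^m are estimated by 1. -/
theorem exists_taylor_bound [CompleteSpace F] {f : EuclideanSpace ℝ (Fin d) → F}
    (hf : ContDiff ℝ ∞ f) (m : ℕ) :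
    ∃ C, 0 ≤ C ∧ ∀ x, ‖x‖ ≤ 1 →
      ‖f x - ∑ k ∈ Finset.range (m + 1), taylorTerm f k x‖ ≤ C * ‖x‖ ^ (m + 1) := by
  have hc : Continuous (iteratedFDeriv ℝ (m + 1) f) :=
    hf.continuous_iteratedFDeriv (by exact_mod_cast le_top)
  obtain ⟨C, hC⟩ := (isCompact_closedBall (0 : EuclideanSpace ℝ (Fin d)) 1).exists_bound_of_continuousOn
    hc.continuousOn
  have hC0 : 0 ≤ C := (norm_nonneg _).trans (hC 0 (by simp))
  refine ⟨C, hC0, fun x hx => ?_⟩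
  have h := map_add_eq_sum_add_integral_iteratedFDeriv (f := f) (x := 0) (y := x) (n := m)
    fun t _ => (hf.of_le (by exact_mod_cast le_top)).contDiffAt
  simp only [zero_add] at h
  rw [h]
  simp only [taylorTerm]
  rw [add_sub_cancel_left, norm_smul]
  have h1 : ‖((m.factorial : ℝ))⁻¹‖ ≤ 1 := by
    rw [norm_inv, Real.norm_natCast]
    exact inv_le_one_of_one_le₀ (by exact_mod_cast m.factorial_pos)
  have h2 : ‖∫ t in (0 : ℝ)..1, (1 - t) ^ m • iteratedFDeriv ℝ (m + 1) f (t • x) fun _ => x‖ ≤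
      (C * ‖x‖ ^ (m + 1)) * |1 - 0| := by
    refine intervalIntegral.norm_integral_le_of_norm_le_const fun t ht => ?_
    rw [Set.uIoc_of_le zero_le_one] at ht
    have h3 := (iteratedFDeriv ℝ (m + 1) f (t • x)).le_opNorm fun _ => x
    rw [Finset.prod_const, Finset.card_univ, Fintype.card_fin] at h3
    have h4 := hC (t • x) (by
      rw [mem_closedBall_zero_iff, norm_smul, Real.norm_of_nonneg ht.1.le]
      exact mul_le_one₀ ht.2 (norm_nonneg _) hx)
    have h5 : ‖(1 - t) ^ m‖ ≤ 1 := by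
      rw [norm_pow]
      refine pow_le_one₀ (norm_nonneg _) ?_
      rw [Real.norm_eq_abs, abs_le]
      constructor <;> linarith [ht.1, ht.2]
    rw [norm_smul]
    calc _ ≤ 1 * ‖iteratedFDeriv ℝ (m + 1) f (t • x) fun _ => x‖ := by gcongr
      _ ≤ C * ‖x‖ ^ (m + 1) := by
        rw [one_mul]
        exact h3.trans (by gcongr)
  calc _ ≤ 1 * (C * ‖x‖ ^ (m + 1) * |1 - 0|) := by gcongr
    _ = _ := by simp

theorem lam_add_one_pos (hd : 0 < d) (hκ : ∀ α ∈ P, 0 ≤ κ α) : 0 < lam P κ + 1 := by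
  have h1 : (0 : ℝ) < d := by exact_mod_cast hd
  have h2 := Finset.sum_nonneg hκ
  rw [lam]
  linarith

/-- The terms of the Pizzetti series are the spherical means of the homogeneous components. -/
theorem pizzettiTerm_eq [CompleteSpace F] (hd : 0 < d) (hR : IsReducedRootSystem R)
    (hP : IsPositiveSystem R P) (hκ : IsMultiplicity R κ) {f : EuclideanSpace ℝ (Fin d) → F}
    (hf : ContDiff ℝ ∞ f) (r : ℝ) (n : ℕ) :
    pizzettiTerm P κ f r n =
      (omega P κ)⁻¹ • r ^ (2 * n) • sphereIntegral P κ (taylorTerm f (2 * n)) := by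
  have hκ' : ∀ α ∈ P, 0 ≤ κ α := fun α h => hκ.nonneg α (hP.subset h)
  obtain ⟨C, -, hC⟩ := exists_taylor_bound hf (2 * n)
  have h := omega_smul_laplacian_iterate hd hR hP hκ hf (contDiff_taylorTerm f)
    (taylorTerm_smul f) n hC
  have hω := omega_pos hd hP hκ'
  rw [← eq_inv_smul_iff₀ hω.ne'] at h
  have h1 := (ascPochhammer_pos n (lam P κ + 1) (lam_add_one_pos hd hκ')).ne'
  have h2 : (n.factorial : ℝ) ≠ 0 := by exact_mod_cast n.factorial_ne_zero
  rw [pizzettiTerm, h, smul_comm]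
  congr 1
  rw [smul_smul]
  congr 1
  rw [div_pow, pow_mul 2]
  norm_num
  field_simp

instance : IsFiniteMeasure (surface d) := by
  unfold surface
  infer_instance

theorem continuous_integrand (hκ : ∀ α ∈ P, 0 ≤ κ α) {f : EuclideanSpace ℝ (Fin d) → F}
    (hf : Continuous f) (r : ℝ) : Continuous (integrand P κ f r) := by
  have h1 : Continuous fun y : Metric.sphere (0 : EuclideanSpace ℝ (Fin d)) 1 =>
      weight P κ (y : EuclideanSpace ℝ (Fin d)) ^ 2 :=
    (continuous_weight_sq hκ).comp continuous_subtype_val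
  exact h1.smul (by fun_prop)

theorem integrable_integrand (hκ : ∀ α ∈ P, 0 ≤ κ α) {f : EuclideanSpace ℝ (Fin d) → F}
    (hf : Continuous f) (r : ℝ) : Integrable (integrand P κ f r) (surface d) :=
  (continuous_integrand hκ hf r).integrable_of_hasCompactSupport (HasCompactSupport.of_compactSpace _)

theorem integral_integrand_taylorTerm (f : EuclideanSpace ℝ (Fin d) → F) (r : ℝ) (k : ℕ) :
    ∫ y, integrand P κ (taylorTerm f k) r y ∂(surface d) =
      r ^ k • sphereIntegral P κ (taylorTerm f k) := by
  rw [sphereIntegral, ← integral_smul]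
  refine integral_congr_ae (Eventually.of_forall fun y => ?_)
  simp only [integrand]
  rw [taylorTerm_smul, smul_comm]

theorem sum_range_eq_sum_even {M : Type*} [AddCommMonoid M] {a : ℕ → M}
    (ha : ∀ k, Odd k → a k = 0) (N : ℕ) :
    ∑ k ∈ Finset.range (2 * N + 1), a k = ∑ n ∈ Finset.range (N + 1), a (2 * n) := by
  induction N with
  | zero => simp
  | succ N ih =>
    rw [Finset.sum_range_succ _ (N + 1), ← ih, show 2 * (N + 1) + 1 = 2 * N + 1 + 1 + 1 by ring,
      Finset.sum_range_succ, Finset.sum_range_succ, ha (2 * N + 1) (by simp), add_zero]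
    rfl

/-- Pizzetti's asymptotic expansion, with an explicit error bound. -/
theorem exists_norm_sphericalMean_sub_le [CompleteSpace F] (hd : 0 < d)
    (hR : IsReducedRootSystem R) (hP : IsPositiveSystem R P) (hκ : IsMultiplicity R κ)
    {f : EuclideanSpace ℝ (Fin d) → F} (hf : ContDiff ℝ ∞ f) (N : ℕ) :
    ∃ C, ∀ r : ℝ, 0 < r → r ≤ 1 →
      ‖sphericalMean P κ f r - ∑ n ∈ Finset.range (N + 1), pizzettiTerm P κ f r n‖ ≤
        C * r ^ (2 * N + 1) := by
  have hκ' : ∀ α ∈ P, 0 ≤ κ α := fun α h => hκ.nonneg α (hP.subset h)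
  have hP0 : ∀ α ∈ P, α ≠ 0 := fun α hα h => hR.zero_notMem (h ▸ hP.subset hα)
  have hω := omega_pos hd hP hκ'
  obtain ⟨C, -, hC⟩ := exists_taylor_bound hf (2 * N)
  refine ⟨C, fun r hr hr1 => ?_⟩
  -- Since odd components integrate to zero, the partial Pizzetti sum is the weighted mean of the
  -- full Taylor polynomial of degree 2N. The pointwise Taylor bound then passes to the normalised
  -- mean with the same constant.
  have h1 : ∑ n ∈ Finset.range (N + 1), pizzettiTerm P κ f r n =
      (omega P κ)⁻¹ • ∑ k ∈ Finset.range (2 * N + 1),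
        ∫ y, integrand P κ (taylorTerm f k) r y ∂(surface d) := by
    simp_rw [integral_integrand_taylorTerm]
    rw [sum_range_eq_sum_even, Finset.smul_sum]
    · exact Finset.sum_congr rfl fun n _ => pizzettiTerm_eq hd hR hP hκ hf r n
    · intro k hk
      rw [sphereIntegral_eq_zero_of_odd hd hP0 hκ' hk (taylorTerm_smul f k), smul_zero]
  have hi : ∀ k ∈ Finset.range (2 * N + 1),
      Integrable (integrand P κ (taylorTerm f k) r) (surface d) := fun k _ =>
    integrable_integrand hκ' (contDiff_taylorTerm f k).continuous r
  have hwi : Integrable (fun y : Metric.sphere (0 : EuclideanSpace ℝ (Fin d)) 1 =>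
      weight P κ (y : EuclideanSpace ℝ (Fin d)) ^ 2) (surface d) := by
    have h := integrable_integrand (F := ℝ) hκ' (continuous_const (y := 1)) 0
    refine h.congr (Eventually.of_forall fun y => ?_)
    simp [integrand]
  rw [h1, sphericalMean, ← smul_sub, ← integral_finsetSum _ hi, ← integral_sub
    (integrable_integrand hκ' hf.continuous r) (integrable_finsetSum _ hi), norm_smul,
    Real.norm_of_nonneg (inv_nonneg.2 hω.le), inv_mul_le_iff₀ hω, omega, ← integral_mul_const]
  refine norm_integral_le_of_norm_le (hwi.mul_const _) (Eventually.of_forall fun y => ?_)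
  simp only [integrand]
  rw [← Finset.smul_sum, ← smul_sub, norm_smul, Real.norm_of_nonneg (sq_nonneg _)]
  have hy : ‖r • (y : EuclideanSpace ℝ (Fin d))‖ = r := by
    rw [norm_smul, Real.norm_of_nonneg hr.le, norm_eq_of_mem_sphere, mul_one]
  have h2 := hC (r • (y : EuclideanSpace ℝ (Fin d))) (hy.le.trans hr1)
  rw [hy] at h2
  gcongr

theorem isLittleO_sphericalMean_sub [CompleteSpace F] (hd : 0 < d)
    (hR : IsReducedRootSystem R) (hP : IsPositiveSystem R P) (hκ : IsMultiplicity R κ)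
    {f : EuclideanSpace ℝ (Fin d) → F} (hf : ContDiff ℝ ∞ f) (N : ℕ) :
    (fun r : ℝ => sphericalMean P κ f r - ∑ n ∈ Finset.range (N + 1), pizzettiTerm P κ f r n)
      =o[𝓝[>] (0 : ℝ)] fun r : ℝ => r ^ (2 * N) := by
  obtain ⟨C, hC⟩ := exists_norm_sphericalMean_sub_le hd hR hP hκ hf N
  have h1 : (fun r : ℝ => sphericalMean P κ f r -
      ∑ n ∈ Finset.range (N + 1), pizzettiTerm P κ f r n)
      =O[𝓝[>] (0 : ℝ)] fun r : ℝ => r ^ (2 * N + 1) := by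
    refine IsBigO.of_bound C ?_
    filter_upwards [Ioc_mem_nhdsGT one_pos] with r hr
    rw [Real.norm_of_nonneg (pow_nonneg hr.1.le _)]
    exact hC r hr.1 hr.2
  exact h1.trans_isLittleO ((isLittleO_pow_pow (by omega)).mono nhdsWithin_le_nhds)

/-- Pizzetti's series for a smooth function that is analytic at the origin. -/
theorem exists_hasSum_pizzettiTerm [CompleteSpace F] (hd : 0 < d)
    (hR : IsReducedRootSystem R) (hP : IsPositiveSystem R P) (hκ : IsMultiplicity R κ)
    {f : EuclideanSpace ℝ (Fin d) → F} (hf : ContDiff ℝ ∞ f) (hfa : AnalyticAt ℝ f 0) :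
    ∃ ρ : ℝ, 0 < ρ ∧ ∀ r : ℝ, 0 < r → r < ρ →
      HasSum (pizzettiTerm P κ f r) (sphericalMean P κ f r) := by
  have hκ' : ∀ α ∈ P, 0 ≤ κ α := fun α h => hκ.nonneg α (hP.subset h)
  have hP0 : ∀ α ∈ P, α ≠ 0 := fun α hα h => hR.zero_notMem (h ▸ hP.subset hα)
  obtain ⟨q, ρ', hq⟩ := hfa
  obtain ⟨ρ, hρ, hρ'⟩ := ENNReal.lt_iff_exists_nnreal_btwn.1 hq.r_pos
  refine ⟨ρ, by exact_mod_cast hρ, fun r hr hrρ => ?_⟩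
  lift r to NNReal using hr.le
  have hrρ' : (r : ENNReal) < ρ' := lt_trans (by exact_mod_cast hrρ) hρ'
  -- On the diagonal the coefficients of any power series of f are its Taylor components, whether or
  -- not they are symmetric.
  have hterm : ∀ k x, taylorTerm f k x = q k fun _ => x := fun k x => by
    rw [taylorTerm, ← hq.factorial_smul, ← Nat.cast_smul_eq_nsmul ℝ, inv_smul_smul₀]
    exact_mod_cast k.factorial_ne_zero
  have hy : ∀ y : Metric.sphere (0 : EuclideanSpace ℝ (Fin d)) 1,
      ‖(r : ℝ) • (y : EuclideanSpace ℝ (Fin d))‖ = r := fun y => by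
    rw [norm_smul, norm_eq_of_mem_sphere, mul_one, NNReal.norm_eq]
  have hsumm : Summable fun k => ‖q k‖ * (r : ℝ) ^ k :=
    q.summable_norm_mul_pow (hrρ'.trans_le hq.r_le)
  have hwc : Continuous fun y : Metric.sphere (0 : EuclideanSpace ℝ (Fin d)) 1 =>
      weight P κ (y : EuclideanSpace ℝ (Fin d)) ^ 2 :=
    (continuous_weight_sq hκ').comp continuous_subtype_val
  have h1 : HasSum (fun k => ∫ y, integrand P κ (taylorTerm f k) r y ∂(surface d))
      (∫ y, integrand P κ f r y ∂(surface d)) := by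
    -- On the sphere of radius r the k-th component is at most ‖q k‖ r^k, which is summable inside
    -- the disc of convergence.
    refine hasSum_integral_of_dominated_convergence
      (fun k y => weight P κ (y : EuclideanSpace ℝ (Fin d)) ^ 2 * (‖q k‖ * (r : ℝ) ^ k))
      (fun k => (integrable_integrand hκ'
        (contDiff_taylorTerm f k).continuous r).aestronglyMeasurable)
      (fun k => Eventually.of_forall fun y => ?_)
      (Eventually.of_forall fun y => hsumm.mul_left _) ?_ (Eventually.of_forall fun y => ?_)
    · rw [integrand, norm_smul, Real.norm_of_nonneg (sq_nonneg _), hterm]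
      refine mul_le_mul_of_nonneg_left ?_ (sq_nonneg _)
      have h := (q k).le_opNorm fun _ => (r : ℝ) • (y : EuclideanSpace ℝ (Fin d))
      rwa [Finset.prod_const, Finset.card_univ, Fintype.card_fin, hy] at h
    · simp_rw [tsum_mul_left]
      exact (hwc.mul continuous_const).integrable_of_hasCompactSupport
        (HasCompactSupport.of_compactSpace _)
    · refine HasSum.const_smul _ ?_
      have h := hq.hasSum_iteratedFDeriv (y := (r : ℝ) • (y : EuclideanSpace ℝ (Fin d))) (by
        rw [Metric.mem_eball, edist_zero_right, ← ofReal_norm, hy, ENNReal.ofReal_coe_nnreal]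
        exact hrρ')
      rw [zero_add] at h
      exact h
  have h2 := h1.const_smul (omega P κ)⁻¹
  rw [← sphericalMean] at h2
  -- The sum over all degrees reduces to the even ones because the terms outside the range of n ↦ 2n
  -- vanish.
  have hinj : Function.Injective fun n : ℕ => 2 * n := fun a b h => by simpa using h
  rw [← hinj.hasSum_iff] at h2
  · convert h2 using 1
    ext n
    rw [pizzettiTerm_eq hd hR hP hκ hf, Function.comp_apply, integral_integrand_taylorTerm]
  · intro k hk
    have hodd : Odd k := by
      rw [← Nat.not_even_iff_odd]
      rintro ⟨m, rfl⟩
      exact hk ⟨m, by simp only; ring⟩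
    rw [integral_integrand_taylorTerm,
      sphereIntegral_eq_zero_of_odd hd hP0 hκ' hodd (taylorTerm_smul f k), smul_zero, smul_zero]

end Pizzetti

/-! ### Reduction to globally smooth functions -/

section Localization

variable {d : ℕ} {F : Type*} [NormedAddCommGroup F] [NormedSpace ℝ F]
  (P : Finset (EuclideanSpace ℝ (Fin d))) (κ : EuclideanSpace ℝ (Fin d) → ℝ)

theorem integrand_congr {f g : EuclideanSpace ℝ (Fin d) → F} {ρ r : ℝ} (hr : 0 < r) (hρ : r < ρ)
    (h : Set.EqOn f g (Metric.ball 0 ρ)) : integrand P κ f r = integrand P κ g r := by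
  ext y
  rw [integrand, integrand, h]
  rw [mem_ball_zero_iff, norm_smul, norm_eq_of_mem_sphere, mul_one, Real.norm_of_nonneg hr.le]
  exact hρ

theorem sphericalMean_congr {f g : EuclideanSpace ℝ (Fin d) → F} {ρ r : ℝ} (hr : 0 < r)
    (hρ : r < ρ) (h : Set.EqOn f g (Metric.ball 0 ρ)) :
    sphericalMean P κ f r = sphericalMean P κ g r := by
  rw [sphericalMean, sphericalMean, integrand_congr P κ hr hρ h]

theorem pizzettiTerm_congr {f g : EuclideanSpace ℝ (Fin d) → F} {ρ : ℝ} (hρ : 0 < ρ)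
    (h : Set.EqOn f g (Metric.ball 0 ρ)) : pizzettiTerm P κ f = pizzettiTerm P κ g := by
  ext r n
  rw [pizzettiTerm, pizzettiTerm,
    laplacian_iterate_eqOn_ball P κ h n (Metric.mem_ball_self hρ)]

/-- A function that is smooth near the origin agrees near the origin with a smooth function. -/
theorem exists_contDiff_eqOn_ball {f : EuclideanSpace ℝ (Fin d) → F}
    {U : Set (EuclideanSpace ℝ (Fin d))} (hU : U ∈ 𝓝 0) (hf : ContDiffOn ℝ ∞ f U) :
    ∃ (ρ : ℝ) (g : EuclideanSpace ℝ (Fin d) → F), 0 < ρ ∧ ContDiff ℝ ∞ g ∧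
      Set.EqOn f g (Metric.ball 0 ρ) := by
  obtain ⟨ε, hε, hεU⟩ := Metric.mem_nhds_iff.1 hU
  let b : ContDiffBump (0 : EuclideanSpace ℝ (Fin d)) :=
    ⟨ε / 4, ε / 2, by linarith, by linarith⟩
  refine ⟨ε / 4, fun x => b x • f x, by linarith, ?_, fun x hx => ?_⟩
  · refine contDiff_iff_contDiffAt.2 fun x => ?_
    by_cases hx : x ∈ Metric.closedBall (0 : EuclideanSpace ℝ (Fin d)) (ε / 2)
    · have hx2 : U ∈ 𝓝 x := mem_of_superset (Metric.isOpen_ball.mem_nhds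
        (Metric.closedBall_subset_ball (by linarith) hx)) hεU
      exact b.contDiff.contDiffAt.smul (hf.contDiffAt hx2)
    · refine (contDiffAt_const (c := (0 : F))).congr_of_eventuallyEq ?_
      filter_upwards [Metric.isClosed_closedBall.isOpen_compl.mem_nhds hx] with y hy
      have hy' : ε / 2 ≤ dist y 0 := (not_le.1 fun h => hy (Metric.mem_closedBall.2 h)).le
      rw [b.zero_of_le_dist hy', zero_smul]
  · simp only
    rw [b.one_of_mem_closedBall (Metric.ball_subset_closedBall hx), one_smul]

end Localization

end Dunkl

theorem corollary3p3 (d : ℕ) (hd : 0 < d)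
    (R P : Finset (EuclideanSpace ℝ (Fin d))) (κ : EuclideanSpace ℝ (Fin d) → ℝ)
    (hR : Dunkl.IsReducedRootSystem R) (hP : Dunkl.IsPositiveSystem R P)
    (hκ : Dunkl.IsMultiplicity R κ)
    {𝕜 : Type*} [RCLike 𝕜] (f : EuclideanSpace ℝ (Fin d) → 𝕜) :
    0 < Dunkl.omega P κ ∧
    ((∃ U ∈ 𝓝 (0 : EuclideanSpace ℝ (Fin d)), ContDiffOn ℝ ∞ f U) →
      (∀ᶠ r in 𝓝[>] (0 : ℝ), Integrable (Dunkl.integrand P κ f r) (Dunkl.surface d)) ∧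
      ∀ N : ℕ,
        (fun r : ℝ => Dunkl.sphericalMean P κ f r -
            ∑ n ∈ Finset.range (N + 1), Dunkl.pizzettiTerm P κ f r n)
          =o[𝓝[>] (0 : ℝ)] fun r : ℝ => r ^ (2 * N)) ∧
    (AnalyticOnNhd ℝ f (Metric.ball 0 1) →
      ∃ ρ : ℝ, 0 < ρ ∧ ρ < 1 ∧ ∀ r : ℝ, 0 < r → r < ρ →
        Integrable (Dunkl.integrand P κ f r) (Dunkl.surface d) ∧
        HasSum (Dunkl.pizzettiTerm P κ f r) (Dunkl.sphericalMean P κ f r)) := by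
  have hκ' : ∀ α ∈ P, 0 ≤ κ α := fun α h => hκ.nonneg α (hP.subset h)
  refine ⟨Dunkl.omega_pos hd hP hκ', ?_, fun hf => ?_⟩
  · rintro ⟨U, hU, hf⟩
    -- Means over small spheres and iterated Laplacians at 0 depend only on values in a ball around
    -- 0, so f may be replaced by a globally smooth function.
    obtain ⟨ρ, g, hρ, hg, hfg⟩ := Dunkl.exists_contDiff_eqOn_ball hU hf
    refine ⟨?_, fun N => ?_⟩
    · filter_upwards [Ioo_mem_nhdsGT hρ] with r hr
      rw [Dunkl.integrand_congr P κ hr.1 hr.2 hfg]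
      exact Dunkl.integrable_integrand hκ' hg.continuous r
    · refine (Dunkl.isLittleO_sphericalMean_sub hd hR hP hκ hg N).congr' ?_ EventuallyEq.rfl
      filter_upwards [Ioo_mem_nhdsGT hρ] with r hr
      rw [Dunkl.sphericalMean_congr P κ hr.1 hr.2 hfg, Dunkl.pizzettiTerm_congr P κ hρ hfg]
  · obtain ⟨ρ, g, hρ, hg, hfg⟩ := Dunkl.exists_contDiff_eqOn_ball
      (Metric.ball_mem_nhds 0 one_pos) hf.contDiffOn_of_completeSpace
    -- The cut-off destroys analyticity in general, but not at 0, where g coincides with f nearby.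
    have hga : AnalyticAt ℝ g 0 := (hf 0 (Metric.mem_ball_self one_pos)).congr
      (hfg.eventuallyEq_of_mem (Metric.ball_mem_nhds 0 hρ))
    obtain ⟨ρ', hρ', hsum⟩ := Dunkl.exists_hasSum_pizzettiTerm hd hR hP hκ hg hga
    -- The radius must respect both the ball where f = g and the convergence of the series; the
    -- bound 1/2 only ensures that it is less than 1.
    refine ⟨min (min ρ ρ') (1 / 2), by positivity,
      (min_le_right _ _).trans_lt (by norm_num), fun r hr hr' => ?_⟩
    have h1 : r < ρ := hr'.trans_le ((min_le_left _ _).trans (min_le_left _ _))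
    have h2 : r < ρ' := hr'.trans_le ((min_le_left _ _).trans (min_le_right _ _))
    rw [Dunkl.integrand_congr P κ hr h1 hfg, Dunkl.sphericalMean_congr P κ hr h1 hfg,
      Dunkl.pizzettiTerm_congr P κ hρ hfg]
    exact ⟨Dunkl.integrable_integrand hκ' hg.continuous r, hsum r hr h2⟩
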